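/- Let $\mathcal U$ be a non-principal ultrafilter on $\mathbb N=\{1,2,\dots\}$ and let $\mathcal Q=\prod_{n\to\mathcal U}M_n(\mathbb C)$ be the tracial ultraproduct of the matrix algebras with their normalized traces: operator-norm-bounded sequences modulo those with $\lim_{n\to\mathcal U}\|x_n\|_2=0$, with trace $\lim_{n\to\mathcal U}\mathrm{tr}_n$; its domain $D_r$ consists of the classes of sequences with $\|x_n\|\le r$ for all $n$. A tracial $\mathrm W^*$-algebra is a $\mathrm W^*$-algebra with a faithful normal tracial state $\tau$; put $\|x\|_2=\tau(x^*x)^{1/2}$ and let $D_r$ be its operator norm ball of radius $r$. Formulas are those of continuous logic in the language of tracial $\mathrm W^*$-algebras: built from $\mathrm{Re}\,\mathrm{tr}(t)$, $\mathrm{Im}\,\mathrm{tr}(t)$ and $d(s,t)=\|s-t\|_2$ for $*$-polynomial terms $s,t$, by continuous connectives $\mathbb R^k\to\mathbb R$ and quantifiers $\sup_{x\in D_r}$, $\inf_{x\in D_r}$ ($r>0$). The type $\mathrm{tp}^{\mathcal M}(\mathbf X)$ of an $\mathbb N$-tuple $\mathbf X$ in $\mathcal M$ is the map $\phi\mapsto\phi^{\mathcal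 M}(\mathbf X)$. Let $\mathbb S$ be the set of types of $\mathbb N$-tuples in tracial $\mathrm W^*$-algebras, and for $\mathbf r\in(0,\infty)^{\mathbb N}$ let $\mathbb S_{\mathbf r}$ be the set of types of tuples with $X_j\in D_{r_j}$ for all $j$; $O\subseteq\mathbb S$ is open if each $O\cap\mathbb S_{\mathbf r}$ is open in $\mathbb S_{\mathbf r}$ for the topology of pointwise convergence on formulas. For $\mathcal K\subseteq\mathbb S$ let $\Gamma^{(n)}_{\mathbf r}(\mathcal K)$ be the set of $\mathbf X\in M_n(\mathbb C)^{\mathbb N}$ with $\|X_j\|\le r_j$ for all $j$ and $\mathrm{tp}^{M_n(\mathbb C)}(\mathbf X)\in\mathcal K$. For finite $F\subseteq\mathbb N$ and $\varepsilon>0$ let $K^{\mathrm{orb}}_{F,\varepsilon}(\Omega)$ be the least cardinality of a set $\Omega'\subseteq M_n(\mathbb C)^{\mathbb N}$ such that for every $\mathbf Y\in\Omega$ there are $\mathbf X\in\Omega'$ and a unitary $V\in M_n(\mathbb C)$ with $\|Y_i-VX_iV^*\|_2<\varepsilon$ for all $i\in F$. The covering entropy of a type $\mu\in\mathbb S$ is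 $$\mathrm{Ent}^{\mathcal U}(\mu)=\sup_{\mathbf r,F,\varepsilon}\ \inf_{O\ni\mu\text{ open}}\ \lim_{n\to\mathcal U}\frac1{n^2}\log K^{\mathrm{orb}}_{F,\varepsilon}\big(\Gamma^{(n)}_{\mathbf r}(O)\big)\in[-\infty,\infty],\qquad \log 0=-\infty,$$ and for a $\mathrm W^*$-subalgebra $\mathcal N$ of a tracial $\mathrm W^*$-algebra $\mathcal M$, $\mathrm{Ent}^{\mathcal U}(\mathcal N:\mathcal M)=\sup_{\mathbf X}\mathrm{Ent}^{\mathcal U}(\mathrm{tp}^{\mathcal M}(\mathbf X))$, over $\mathbb N$-tuples $\mathbf X$ in $\mathcal N$. Then: 1. For every $\mu\in\mathbb S$, either $\mathrm{Ent}^{\mathcal U}(\mu)\ge 0$ or $\mathrm{Ent}^{\mathcal U}(\mu)=-\infty$. Moreover $\mathrm{Ent}^{\mathcal U}(\mu)\ge0$ if and only if there is an $\mathbb N$-tuple $\mathbf X$ in $\mathcal Q$ with $\mathrm{tp}^{\mathcal Q}(\mathbf X)=\mu$. 2. If $\mathcal M$ is a separable (i.e. $\|\cdot\|_2$-separable) tracial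 $\mathrm W^*$-algebra, $\mathcal N\subseteq\mathcal M$ is a $\mathrm W^*$-subalgebra and $\mathrm{Ent}^{\mathcal U}(\mathcal N:\mathcal M)\ge0$, then there is an elementary embedding $\iota:\mathcal M\to\mathcal Q$: an injective, trace-preserving unital $*$-homomorphism, mapping $D_r$ into $D_r$ for every $r>0$, with $\phi^{\mathcal Q}(\iota(\mathbf X))=\phi^{\mathcal M}(\mathbf X)$ for every $\mathbb N$-tuple $\mathbf X$ in $\mathcal M$ and every definable predicate $\phi$ relative to the theory $\mathrm T_{\mathrm{tr}}$ of tracial $\mathrm W^*$-algebras (a family of functions $\phi^{\mathcal A}$ of $\mathbb N$-tuples such that, for every $\mathbf r\in(0,\infty)^{\mathbb N}$ and $\varepsilon>0$, some formula $\psi$ satisfies $|\phi^{\mathcal A}-\psi^{\mathcal A}|<\varepsilon$ on $\prod_jD_{r_j}^{\mathcal A}$ for all models $\mathcal A$ of $\mathrm T_{\mathrm{tr}}$). -/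

import Mathlib

universe u

namespace TracialEntropy

open Filter Topology
open scoped ComplexOrder Matrix.Norms.L2Operator

/-! ### Structures, terms and formulas -/

/-- Interpretation of the symbols of the language of tracial `W*`-algebras: a unital
`*`-algebra over `ℂ` (interpreting `+`, `·`, `*`, the scalar multiplications, `0` and `1`),
a linear functional `tr` (interpreting `Re tr` and `Im tr`), and domains of quantification `D r`
for `r > 0`. The metric symbol is interpreted by `dist₂` below. -/
structure TracialStructure where
  carrier : Type u
  [ring : Ring carrier]
  [starRing : StarRing carrier]
  [algebra : Algebra ℂ carrier]
  [starModule : StarModule ℂ carrier]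
  tr : carrier →ₗ[ℂ] ℂ
  D : ℝ → Set carrier

attribute [instance] TracialStructure.ring TracialStructure.starRing TracialStructure.algebra
  TracialStructure.starModule

instance : CoeSort TracialStructure.{u} (Type u) := ⟨TracialStructure.carrier⟩

/-- The norm `‖x‖₂ = tr(x* x)^{1/2}`. -/
noncomputable def TracialStructure.norm₂ (A : TracialStructure.{u}) (x : A) : ℝ :=
  Real.sqrt (A.tr (star x * x)).re

/-- The metric `d(x, y) = ‖x - y‖₂`. -/
noncomputable def TracialStructure.dist₂ (A : TracialStructure.{u}) (x y : A) : ℝ :=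
  A.norm₂ (x - y)

/-- Terms in the variables `x₀, x₁, …`. (The symbols `t_p` for evaluation of a non-commutative
polynomial `p` are not listed separately: their interpretations are given by these terms.) -/
inductive Term : Type
  | var (i : ℕ)
  | zero
  | one
  | add (s t : Term)
  | mul (s t : Term)
  | star (t : Term)
  | smul (c : ℂ) (t : Term)

/-- Interpretation of a term at an assignment `X` of the variables. -/
def Term.eval (A : TracialStructure.{u}) (X : ℕ → A) : Term → A
  | .var i => X i
  | .zero => 0
  | .one => 1
  | .add s t => s.eval A X + t.eval A X
  | .mul s t => s.eval A X * t.eval A X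
  | .star t => Star.star (t.eval A X)
  | .smul c t => c • t.eval A X

/-- The variables occurring in a term. -/
def Term.vars : Term → Set ℕ
  | .var i => {i}
  | .zero => ∅
  | .one => ∅
  | .add s t => s.vars ∪ t.vars
  | .mul s t => s.vars ∪ t.vars
  | .star t => t.vars
  | .smul _ t => t.vars

/-- Formulas of continuous logic in the language of tracial `W*`-algebras: basic formulas
`Re tr(t)`, `Im tr(t)`, `d(s, t)`; continuous connectives `F : ℝ^k → ℝ`; and the quantifiers
`sup_{x_i ∈ D_r}`, `inf_{x_i ∈ D_r}` with `r > 0`. -/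
inductive Formula : Type
  | reTr (t : Term)
  | imTr (t : Term)
  | dist (s t : Term)
  | conn {k : ℕ} (F : C(Fin k → ℝ, ℝ)) (φ : Fin k → Formula)
  | sup (i : ℕ) (r : Set.Ioi (0 : ℝ)) (φ : Formula)
  | inf (i : ℕ) (r : Set.Ioi (0 : ℝ)) (φ : Formula)

/-- Interpretation of a formula at an assignment `X` of the variables. -/
noncomputable def Formula.eval (A : TracialStructure.{u}) : Formula → (ℕ → A) → ℝ
  | .reTr t, X => (A.tr (t.eval A X)).re
  | .imTr t, X => (A.tr (t.eval A X)).im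
  | .dist s t, X => A.dist₂ (s.eval A X) (t.eval A X)
  | .conn F φ, X => F fun l => (φ l).eval A X
  | .sup i r φ, X => ⨆ a : A.D r, φ.eval A (Function.update X i a)
  | .inf i r φ, X => ⨅ a : A.D r, φ.eval A (Function.update X i a)

/-- The free variables of a formula. -/
def Formula.freeVars : Formula → Set ℕ
  | .reTr t => t.vars
  | .imTr t => t.vars
  | .dist s t => s.vars ∪ t.vars
  | .conn _ φ => ⋃ l, (φ l).freeVars
  | .sup i _ φ => φ.freeVars \ {i}
  | .inf i _ φ => φ.freeVars \ {i}

/-- A sentence is a formula without free variables. -/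
def Formula.IsSentence (φ : Formula) : Prop := φ.freeVars = ∅

/-- The type of the tuple `X` in `A`. -/
noncomputable def tp (A : TracialStructure.{u}) (X : ℕ → A) : Formula → ℝ :=
  fun φ => φ.eval A X

/-! ### Tracial `W*`-algebras -/

/-- A Banach space predual of a `C*`-algebra `M`, in the (conjugate-linear) convention of
`WStarAlgebra`. -/
structure Predual (M : Type u) [CStarAlgebra M] where
  X : Type u
  [normedAddCommGroup : NormedAddCommGroup X]
  [normedSpace : NormedSpace ℂ X]
  [completeSpace : CompleteSpace X]
  equiv : StrongDual ℂ X ≃ₗᵢ⋆[ℂ] M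

attribute [instance] Predual.normedAddCommGroup Predual.normedSpace Predual.completeSpace

/-- The identification of the dual of the predual, with its weak-* topology, with `M`. -/
noncomputable def Predual.ofWeakDual {M : Type u} [CStarAlgebra M] (P : Predual M) (f : WeakDual ℂ P.X) : M :=
  P.equiv (WeakDual.toStrongDual f)

/-- A tracial `W*`-algebra: a `W*`-algebra with a faithful normal (weak-* continuous) tracial
state. (The predual of a `W*`-algebra is unique, so the choice of a predual in `normal` is
immaterial.) -/
structure TracialWStarAlgebra where
  carrier : Type u
  [cstar : CStarAlgebra carrier]
  [wstar : WStarAlgebra carrier]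
  τ : carrier →ₗ[ℂ] ℂ
  nonneg : ∀ x, 0 ≤ τ (star x * x)
  unital : τ 1 = 1
  tracial : ∀ x y, τ (x * y) = τ (y * x)
  faithful : ∀ x, τ (star x * x) = 0 → x = 0
  normal : ∃ P : Predual carrier, Continuous fun f : WeakDual ℂ P.X => τ (P.ofWeakDual f)

attribute [instance] TracialWStarAlgebra.cstar TracialWStarAlgebra.wstar

instance : CoeSort TracialWStarAlgebra.{u} (Type u) := ⟨TracialWStarAlgebra.carrier⟩

/-- A tracial `W*`-algebra as a structure: the domain `D r` is the operator norm ball of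
radius `r`. -/
noncomputable abbrev TracialWStarAlgebra.str (M : TracialWStarAlgebra.{u}) : TracialStructure.{u} where
  carrier := M
  tr := M.τ
  D r := {x : M | ‖x‖ ≤ r}

/-- `M` is separable: it is separable for the metric `d(x, y) = ‖x - y‖₂`, that is,
`L²(M, τ)` is separable. -/
def TracialWStarAlgebra.IsSeparable (M : TracialWStarAlgebra.{u}) : Prop :=
  ∃ S : Set M, S.Countable ∧ ∀ x : M, ∀ ε : ℝ, 0 < ε → ∃ y ∈ S, M.str.dist₂ x y < ε

/-- A `W*`-subalgebra: a weak-* closed unital `*`-subalgebra. -/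
structure WStarSubalgebra (M : TracialWStarAlgebra.{u}) extends StarSubalgebra ℂ M where
  isClosed_weakStar : ∃ P : Predual M, IsClosed {f : WeakDual ℂ P.X | P.ofWeakDual f ∈ carrier}

/-! ### The space of types -/

/-- The space of types of `ℕ`-tuples in models of the theory of tracial `W*`-algebras; these models
are exactly the tracial `W*`-algebras. -/
structure TypeSpace : Type where
  val : Formula → ℝ
  exists_realization : ∃ (M : TracialWStarAlgebra.{u}) (X : ℕ → M), tp M.str X = val

/-- The type of a tuple in a tracial `W*`-algebra, as a point of the space of types. -/
noncomputable def TracialWStarAlgebra.tp (M : TracialWStarAlgebra.{u}) (X : ℕ → M) :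
    TypeSpace.{u} :=
  ⟨TracialEntropy.tp M.str X, M, X, rfl⟩

/-- The types of tuples `X` with `X_j` in the domain `D_{r_j}` for all `j`. -/
def TypeSpace.bounded (r : ℕ → ℝ) : Set TypeSpace.{u} :=
  {μ | ∃ (M : TracialWStarAlgebra.{u}) (X : ℕ → M),
    (∀ j, X j ∈ M.str.D (r j)) ∧ tp M.str X = μ.val}

/-- The logic topology: a set is open iff for every `r ∈ (0,∞)^ℕ` its trace on the types bounded
by `r` is open for the topology of pointwise convergence on formulas. -/
instance : TopologicalSpace TypeSpace.{u} :=
  ⨆ r : {r : ℕ → ℝ // ∀ j, 0 < r j},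
    TopologicalSpace.coinduced (Subtype.val : TypeSpace.bounded.{u} r.1 → TypeSpace.{u})
      (TopologicalSpace.induced (fun μ : TypeSpace.bounded.{u} r.1 => μ.1.val) inferInstance)

/-! ### Matrix algebras and covering entropy -/

/-- The algebra of complex `n × n` matrices (in an arbitrary universe). -/
abbrev Mat (n : ℕ+) : Type u := Matrix (ULift.{u} (Fin n)) (ULift.{u} (Fin n)) ℂ

/-- The normalized trace. -/
noncomputable def ntr (n : ℕ+) : Mat.{u} n →ₗ[ℂ] ℂ :=
  ((n : ℕ) : ℂ)⁻¹ • Matrix.traceLinearMap (ULift.{u} (Fin n)) ℂ ℂ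

/-- The normalized Hilbert-Schmidt norm `‖x‖₂ = tr_n(x* x)^{1/2}` of a matrix. -/
noncomputable def hsNorm (n : ℕ+) (x : Mat.{u} n) : ℝ := Real.sqrt (ntr n (star x * x)).re

/-- `M_n(ℂ)` with its normalized trace and its operator norm balls. -/
noncomputable abbrev matStr (n : ℕ+) : TracialStructure.{u} where
  carrier := Mat.{u} n
  tr := ntr n
  D r := {x : Mat.{u} n | ‖x‖ ≤ r}

/-- The microstate space `Γ_r^{(n)}(K)`. -/
def microstates (r : ℕ → ℝ) (n : ℕ+) (K : Set TypeSpace.{u}) : Set (ℕ → Mat.{u} n) :=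
  {X | (∀ j, X j ∈ (matStr.{u} n).D (r j)) ∧ ∃ μ ∈ K, μ.val = tp (matStr n) X}

/-- The orbital `(F, ε)`-neighbourhood of `Ω`. -/
def orbNhd {n : ℕ+} (F : Finset ℕ) (ε : ℝ) (Ω : Set (ℕ → Mat.{u} n)) :
    Set (ℕ → Mat.{u} n) :=
  {Y | ∃ V ∈ unitary (Mat.{u} n), ∃ X ∈ Ω,
    ∀ i ∈ F, hsNorm n (Y i - V * X i * star V) < ε}

/-- The orbital covering number: the minimal cardinality of a set that orbitally
`(F, ε)`-covers `Ω`. -/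
noncomputable def orbCoveringNumber {n : ℕ+} (F : Finset ℕ) (ε : ℝ)
    (Ω : Set (ℕ → Mat.{u} n)) : ℕ∞ :=
  ⨅ (Ω' : Set (ℕ → Mat.{u} n)) (_ : Ω ⊆ orbNhd F ε Ω'), Ω'.encard

/-- `Ent^U_{r,F,ε}(K)`, with values in `[-∞, ∞]` and `log 0 = -∞`. -/
noncomputable def entAux (U : Ultrafilter ℕ+) (r : ℕ → ℝ) (F : Finset ℕ) (ε : ℝ)
    (K : Set TypeSpace.{u}) : EReal :=
  ⨅ (O : Set TypeSpace.{u}) (_ : IsOpen O ∧ K ⊆ O),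
    limUnder (U : Filter ℕ+) fun n : ℕ+ =>
      ENNReal.log (orbCoveringNumber F ε (microstates r n O) : ENNReal) / (((n : ℕ) ^ 2 : ℝ) : EReal)

/-- `Ent^U_r(K)`. -/
noncomputable def entRadius (U : Ultrafilter ℕ+) (r : ℕ → ℝ) (K : Set TypeSpace.{u}) : EReal :=
  ⨆ (F : Finset ℕ) (ε : ℝ) (_ : 0 < ε), entAux U r F ε K

/-- The covering entropy `Ent^U(K)` of a set of types. -/
noncomputable def entSet (U : Ultrafilter ℕ+) (K : Set TypeSpace.{u}) : EReal :=
  ⨆ (r : ℕ → ℝ) (_ : ∀ j, 0 < r j), entRadius U r K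

/-- The covering entropy `Ent^U(μ)` of a type. -/
noncomputable def ent (U : Ultrafilter ℕ+) (μ : TypeSpace.{u}) : EReal := entSet U {μ}

/-- The covering entropy `Ent^U(N : M)` of a `W*`-subalgebra. -/
noncomputable def entSubalgebra (U : Ultrafilter ℕ+) {M : TracialWStarAlgebra.{u}}
    (N : WStarSubalgebra M) : EReal :=
  ⨆ X : ℕ → N.toStarSubalgebra, ent U (M.tp fun j => (X j : M))

/-! ### The matrix ultraproduct -/

/-- `‖x‖₂²` for the normalized trace, in terms of the entries. -/
theorem ntr_star_mul_self (n : ℕ+) (x : Mat.{u} n) :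
    ntr n (star x * x) = ((((n : ℕ) : ℝ)⁻¹ * ∑ j, ∑ i, ‖x i j‖ ^ 2 : ℝ) : ℂ) := by
  simp only [ntr, LinearMap.smul_apply, Matrix.traceLinearMap_apply, Matrix.trace, Matrix.diag,
    Matrix.mul_apply, Matrix.star_apply, smul_eq_mul]
  push_cast
  congr 1
  refine Finset.sum_congr rfl fun j _ => Finset.sum_congr rfl fun i _ => ?_
  rw [← Complex.conj_mul']
  rfl

theorem hsNorm_sq (n : ℕ+) (x : Mat.{u} n) :
    hsNorm n x ^ 2 = ((n : ℕ) : ℝ)⁻¹ * ∑ j, ∑ i, ‖x i j‖ ^ 2 := by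
  have h : hsNorm n x = √(ntr n (star x * x)).re := rfl
  rw [h, ntr_star_mul_self, Complex.ofReal_re, Real.sq_sqrt (by positivity)]

theorem hsNorm_nonneg (n : ℕ+) (x : Mat.{u} n) : 0 ≤ hsNorm n x := Real.sqrt_nonneg _

theorem hsNorm_star (n : ℕ+) (x : Mat.{u} n) :
    hsNorm n (star x) = hsNorm n x := by
  rw [← sq_eq_sq₀ (hsNorm_nonneg _ _) (hsNorm_nonneg _ _), hsNorm_sq, hsNorm_sq, Finset.sum_comm]
  congr 1
  refine Finset.sum_congr rfl fun j _ => Finset.sum_congr rfl fun i _ => ?_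
  have : (star x : Mat.{u} n) j i = star (x i j) := rfl
  rw [← norm_star (x i j), ← this]

theorem hsNorm_add_sq_le (n : ℕ+) (x y : Mat.{u} n) :
    hsNorm n (x + y) ^ 2 ≤ 2 * hsNorm n x ^ 2 + 2 * hsNorm n y ^ 2 := by
  rw [hsNorm_sq, hsNorm_sq, hsNorm_sq]
  have key : ∑ j, ∑ i, ‖(x + y : Mat.{u} n) i j‖ ^ 2 ≤
      2 * ∑ j, ∑ i, ‖x i j‖ ^ 2 + 2 * ∑ j, ∑ i, ‖y i j‖ ^ 2 := by
    simp only [Finset.mul_sum, ← Finset.sum_add_distrib]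
    refine Finset.sum_le_sum fun j _ => Finset.sum_le_sum fun i _ => ?_
    have h := norm_add_le (x i j) (y i j)
    have h0 := norm_nonneg (x i j + (y : Mat.{u} n) i j)
    rw [Matrix.add_apply]
    nlinarith [sq_nonneg (‖x i j‖ - ‖y i j‖)]
  have hn : (0 : ℝ) ≤ ((n : ℕ) : ℝ)⁻¹ := by positivity
  have := mul_le_mul_of_nonneg_left key hn
  refine this.trans (le_of_eq ?_)
  ring

theorem hsNorm_mul_le (n : ℕ+) (x y : Mat.{u} n) :
    hsNorm n (x * y) ≤ ‖x‖ * hsNorm n y := by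
  rw [← sq_le_sq₀ (hsNorm_nonneg _ _) (mul_nonneg (norm_nonneg _) (hsNorm_nonneg _ _)), mul_pow,
    hsNorm_sq, hsNorm_sq, mul_left_comm]
  refine mul_le_mul_of_nonneg_left ?_ (by positivity)
  rw [Finset.mul_sum]
  refine Finset.sum_le_sum fun j _ => ?_
  have h := Matrix.l2_opNorm_mulVec x
    (WithLp.toLp 2 fun i => y i j)
  have h2 := pow_le_pow_left₀ (norm_nonneg _) h 2
  rw [mul_pow, EuclideanSpace.norm_sq_eq, EuclideanSpace.norm_sq_eq] at h2
  exact h2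

theorem norm_ntr_le (n : ℕ+) (x : Mat.{u} n) : ‖ntr n x‖ ≤ hsNorm n x := by
  rw [← sq_le_sq₀ (norm_nonneg _) (hsNorm_nonneg _ _), hsNorm_sq]
  have h0 : ntr n x = ((n : ℕ) : ℂ)⁻¹ * ∑ i, x i i := rfl
  have hn : (0 : ℝ) < (n : ℕ) := by exact_mod_cast n.pos
  have h1 : ‖∑ i, x i i‖ ^ 2 ≤ (n : ℕ) * ∑ i, ‖x i i‖ ^ 2 := by
    have h2 := pow_le_pow_left₀ (norm_nonneg _)
      (norm_sum_le Finset.univ fun i => x i i) 2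
    refine h2.trans ((sq_sum_le_card_mul_sum_sq).trans (le_of_eq ?_))
    simp
  have h3 : ∑ i, ‖x i i‖ ^ 2 ≤ ∑ j, ∑ i, ‖x i j‖ ^ 2 :=
    Finset.sum_le_sum fun j _ =>
      Finset.single_le_sum (f := fun i => ‖x i j‖ ^ 2)
        (fun i _ => sq_nonneg _) (Finset.mem_univ j)
  rw [h0, norm_mul, mul_pow, norm_inv, Complex.norm_natCast]
  calc (((n : ℕ) : ℝ)⁻¹) ^ 2 * ‖∑ i, x i i‖ ^ 2
      ≤ (((n : ℕ) : ℝ)⁻¹) ^ 2 * ((n : ℕ) * ∑ j, ∑ i, ‖x i j‖ ^ 2) :=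
        mul_le_mul_of_nonneg_left (h1.trans (mul_le_mul_of_nonneg_left h3 hn.le)) (by positivity)
    _ = _ := by field_simp

theorem hsNorm_le (n : ℕ+) (x : Mat.{u} n) : hsNorm n x ≤ ‖x‖ := by
  have h := hsNorm_mul_le n x 1
  rw [mul_one] at h
  refine h.trans (mul_le_of_le_one_right (norm_nonneg _) ?_)
  have h1 : hsNorm.{u} n 1 = √(ntr n (star (1 : Mat.{u} n) * 1)).re := rfl
  have hn : ((n : ℕ) : ℂ) ≠ 0 := by exact_mod_cast n.ne_zero
  rw [h1, star_one, mul_one]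
  simp [ntr, hn]

/-- The confined tuples: sequences of matrices `x_n ∈ M_n(ℂ)` that are bounded in operator norm. -/
def boundedSeq : StarSubalgebra ℂ (∀ n : ℕ+, Mat.{u} n) where
  carrier := {x | ∃ C : ℝ, ∀ n, ‖x n‖ ≤ C}
  mul_mem' := by
    rintro x y ⟨C, hC⟩ ⟨C', hC'⟩
    exact ⟨C * C', fun n => (norm_mul_le _ _).trans
      (mul_le_mul (hC n) (hC' n) (norm_nonneg _) ((norm_nonneg _).trans (hC n)))⟩
  add_mem' := by
    rintro x y ⟨C, hC⟩ ⟨C', hC'⟩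
    exact ⟨C + C', fun n => (norm_add_le _ _).trans (add_le_add (hC n) (hC' n))⟩
  algebraMap_mem' c := ⟨‖c‖, fun n => by
    rw [Pi.algebraMap_apply, norm_algebraMap']⟩
  star_mem' := by
    rintro x ⟨C, hC⟩
    exact ⟨C, fun n => by rw [Pi.star_apply, norm_star]; exact hC n⟩

/-- The bounded sequences `x` with `lim_{n → U} ‖x_n‖₂ = 0`. -/
def nullIdeal (U : Ultrafilter ℕ+) : Ideal boundedSeq.{u} where
  carrier := {x | Tendsto (fun n => hsNorm n (x.1 n)) (U : Filter ℕ+) (𝓝 0)}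
  zero_mem' := by
    have : ∀ n, hsNorm.{u} n 0 = 0 := fun n => by
      simp [hsNorm]
    have h : (fun n => hsNorm n ((0 : boundedSeq.{u}).1 n)) = fun _ => 0 :=
      funext fun n => this n
    rw [Set.mem_ofPred_eq, h]
    exact tendsto_const_nhds
  add_mem' := by
    intro x y hx hy
    have h : Tendsto (fun n => √(2 * hsNorm n (x.1 n) ^ 2 +
        2 * hsNorm n (y.1 n) ^ 2)) (U : Filter ℕ+) (𝓝 0) := by
      have := (((hx.pow 2).const_mul 2).add ((hy.pow 2).const_mul 2)).sqrt
      simpa using this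
    exact squeeze_zero (fun n => hsNorm_nonneg _ _)
      (fun n => Real.le_sqrt_of_sq_le (hsNorm_add_sq_le n _ _)) h
  smul_mem' := by
    rintro ⟨x, C, hC⟩ y hy
    have h := hy.const_mul C
    rw [mul_zero] at h
    exact squeeze_zero (fun n => hsNorm_nonneg _ _) (fun n => (hsNorm_mul_le n _ _).trans
      (mul_le_mul_of_nonneg_right (hC n) (hsNorm_nonneg _ _))) h

theorem star_mem_nullIdeal {U : Ultrafilter ℕ+} {x : boundedSeq.{u}} (hx : x ∈ nullIdeal U) :
    star x ∈ nullIdeal U := by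
  have h : (fun n => hsNorm n ((star x : boundedSeq.{u}).1 n)) =
      fun n => hsNorm n (x.1 n) := funext fun n => hsNorm_star n (x.1 n)
  change Tendsto _ _ _
  rw [h]
  exact hx

instance (U : Ultrafilter ℕ+) : (nullIdeal.{u} U).IsTwoSided where
  mul_mem_of_left {x} y hx := by
    have h := star_mem_nullIdeal ((nullIdeal U).mul_mem_left (star y) (star_mem_nullIdeal hx))
    rwa [star_mul, star_star, star_star] at h

/-- The ultraproduct `L^∞(Q)`: bounded sequences modulo `d`-distance zero along `U`. -/
abbrev UltraCarrier (U : Ultrafilter ℕ+) : Type u := boundedSeq.{u} ⧸ nullIdeal.{u} U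

noncomputable instance (U : Ultrafilter ℕ+) : StarRing (UltraCarrier.{u} U) where
  star := Quotient.map' star fun a b h => by
    rw [Submodule.quotientRel_def] at h ⊢
    exact (star_sub a b) ▸ star_mem_nullIdeal h
  star_involutive := by
    rintro ⟨x⟩
    exact congrArg (Ideal.Quotient.mk (nullIdeal U)) (star_star x)
  star_mul := by
    rintro ⟨x⟩ ⟨y⟩
    exact congrArg (Ideal.Quotient.mk (nullIdeal U)) (star_mul x y)
  star_add := by
    rintro ⟨x⟩ ⟨y⟩
    exact congrArg (Ideal.Quotient.mk (nullIdeal U)) (star_add x y)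

noncomputable instance (U : Ultrafilter ℕ+) : StarModule ℂ (UltraCarrier.{u} U) where
  star_smul c := by
    rintro ⟨x⟩
    exact congrArg (Ideal.Quotient.mk (nullIdeal U)) (star_smul c x)

theorem tendsto_ntr (U : Ultrafilter ℕ+) (x : boundedSeq.{u}) :
    Tendsto (fun n => ntr n (x.1 n)) (U : Filter ℕ+)
      (𝓝 (limUnder (U : Filter ℕ+) fun n => ntr n (x.1 n))) := by
  obtain ⟨x, C, hC⟩ := x
  apply tendsto_nhds_limUnder
  have hK := isCompact_closedBall (0 : ℂ) C
  obtain ⟨a, -, ha⟩ := hK.ultrafilter_le_nhds (U.map fun n => ntr n (x n)) (by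
    rw [le_principal_iff]
    refine Filter.mem_map.2 (Filter.Eventually.of_forall fun n => ?_)
    refine mem_closedBall_zero_iff.2 ?_
    exact (norm_ntr_le n _).trans ((hsNorm_le n _).trans (hC n)))
  exact ⟨a, ha⟩

/-- The limit along `U` of the normalized traces, on bounded sequences. -/
noncomputable def limTr (U : Ultrafilter ℕ+) : boundedSeq.{u} →ₗ[ℂ] ℂ where
  toFun x := limUnder (U : Filter ℕ+) fun n => ntr n (x.1 n)
  map_add' x y := by
    refine (((tendsto_ntr U x).add (tendsto_ntr U y)).congr fun n => ?_).limUnder_eq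
    exact (map_add (ntr n) _ _).symm
  map_smul' c x := by
    refine (((tendsto_ntr U x).const_smul c).congr fun n => ?_).limUnder_eq
    exact (map_smul (ntr n) _ _).symm

theorem limTr_eq_zero (U : Ultrafilter ℕ+) (x : boundedSeq.{u}) (hx : x ∈ nullIdeal U) :
    limTr U x = 0 :=
  (squeeze_zero_norm (fun n => norm_ntr_le n (x.1 n)) hx).limUnder_eq

/-- The matrix ultraproduct `Q = ∏_{n → U} M_n(ℂ)`: its trace is `lim_{n → U} tr_n`, and its domain
`D r` consists of the classes of sequences `x` with `‖x_n‖ ≤ r` for all `n`. -/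
noncomputable abbrev matUltraproduct (U : Ultrafilter ℕ+) : TracialStructure.{u} where
  carrier := UltraCarrier.{u} U
  tr := ((nullIdeal.{u} U).restrictScalars ℂ).liftQ (limTr U) fun x hx => limTr_eq_zero U x hx
  D r := {a | ∃ x : boundedSeq.{u}, (∀ n, ‖x.1 n‖ ≤ r) ∧ Ideal.Quotient.mk (nullIdeal U) x = a}

/-! ### Elementary embeddings -/

/-- The theory of tracial `W*`-algebras: the sentences that vanish in all of them. -/
def tracialTheory : Set Formula :=
  {σ | σ.IsSentence ∧ ∀ (M : TracialWStarAlgebra.{u}) (X : ℕ → M), σ.eval M.str X = 0}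

/-- `A` is a model of the theory `T`. -/
def TracialStructure.Models (A : TracialStructure.{u}) (T : Set Formula) : Prop :=
  ∀ σ ∈ T, ∀ X : ℕ → A, σ.eval A X = 0

/-- Definable predicates relative to a theory `T`: on every product of domains, they are
approximated by formulas, uniformly over all models of `T`. -/
def IsDefinablePredicate (T : Set Formula)
    (φ : ∀ A : TracialStructure.{u}, (ℕ → A) → ℝ) : Prop :=
  ∀ r : ℕ → ℝ, (∀ j, 0 < r j) → ∀ ε : ℝ, 0 < ε → ∃ ψ : Formula,
    ∀ A : TracialStructure.{u}, A.Models T → ∀ X : ℕ → A, (∀ j, X j ∈ A.D (r j)) →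
      |φ A X - ψ.eval A X| < ε

/-- Embeddings of structures: injective unital `*`-homomorphisms that preserve the trace and map
domains of quantification into domains of quantification. -/
structure IsEmbedding {A B : TracialStructure.{u}} (ι : A →⋆ₐ[ℂ] B) : Prop where
  injective : Function.Injective ι
  tr_map : ∀ x, B.tr (ι x) = A.tr x
  map_mem : ∀ r : ℝ, 0 < r → ∀ x ∈ A.D r, ι x ∈ B.D r

/-- Elementary embeddings: embeddings that preserve the values of all definable predicates relative
to the theory of tracial `W*`-algebras. -/
structure IsElementaryEmbedding {A B : TracialStructure.{u}} (ι : A →⋆ₐ[ℂ] B) : Prop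
    extends IsEmbedding ι where
  eval_map : ∀ φ : ∀ C : TracialStructure.{u}, (ℕ → C) → ℝ,
    IsDefinablePredicate tracialTheory.{u} φ → ∀ X : ℕ → A, φ B (fun j => ι (X j)) = φ A X

end TracialEntropy

open TracialEntropy

namespace TracialEntropy

open Filter Topology
open scoped ComplexOrder Matrix.Norms.L2Operator

/-! ### Matrix algebras as tracial `W*`-algebras -/

section FiniteDimensional

/-! Entropy different from `⊥` says no more than that every open neighbourhood of the type has
matrix microstates along `U`: an empty microstate space has covering number 0 and a nonempty one has
covering number at least 1. The first claim thus reduces to the equivalence of approximate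
realization in matrices and exact realization in the ultraproduct.

From `matUltraproduct` to matrices this is the theorem of Łoś, `Formula.tendsto_eval`. Openness only
constrains a set of types on the bounded types, so one must also know that the type satisfies the
norm bounds of the chosen matrix lifts. This holds because an operator norm bound is expressed by
the vanishing of formulas (`Formula.normExcess`), a condition that passes from the matrices to the
limit and then to a realization of the type.

From matrices to `matUltraproduct` this is countable saturation, `exists_tp_classes_eq`. A countable
set of formulas approximates all formulas uniformly over tracial `W*`-algebras
(`exists_countable_formulas_approx`), so a diagonal sequence of microstates (`exists_diagonal`)
realizes the whole type. Here it matters that `U` is non-principal.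

For the second claim, one tuple with entropy different from `⊥` has its type realized in the
ultraproduct, so `M` and the ultraproduct agree on sentences. Saturation then realizes the type of a
dense sequence of `M`, and, over this realization, the type of any further tuple. The image of an
element is determined by its distances to the image of the dense sequence, so these extensions fit
together to one map that preserves all formulas. Such a map is a `*`-homomorphism and preserves
definable predicates, since both structures are models of the theory. -/

theorem finiteDimensional_strongDual (E : Type*) [NormedAddCommGroup E] [NormedSpace ℂ E]
    [FiniteDimensional ℂ E] : FiniteDimensional ℂ (StrongDual ℂ E) :=
  LinearEquiv.finiteDimensional (LinearMap.toContinuousLinearMap (𝕜 := ℂ) (E := E) (F' := ℂ))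

theorem finrank_strongDual (E : Type*) [NormedAddCommGroup E] [NormedSpace ℂ E]
    [FiniteDimensional ℂ E] : Module.finrank ℂ (StrongDual ℂ E) = Module.finrank ℂ E :=
  (LinearMap.toContinuousLinearMap (𝕜 := ℂ) (E := E) (F' := ℂ)).finrank_eq.symm.trans
    Subspace.dual_finrank_eq

variable (M : Type u) [CStarAlgebra M] [FiniteDimensional ℂ M]

/-- A finite-dimensional `C*`-algebra is linearly isometric to its double dual. -/
noncomputable def doubleDualEquiv : M ≃ₗᵢ[ℂ] StrongDual ℂ (StrongDual ℂ M) :=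
  haveI := finiteDimensional_strongDual M
  haveI := finiteDimensional_strongDual (StrongDual ℂ M)
  (NormedSpace.inclusionInDoubleDualLi ℂ (E := M)).toLinearIsometryEquiv (by
    rw [finrank_strongDual (StrongDual ℂ M), finrank_strongDual])

/-- The dual of a finite-dimensional `C*`-algebra is a predual of it. -/
noncomputable def finiteDimensionalPredual : Predual M where
  X := StrongDual ℂ M
  equiv := (doubleDualEquiv M).symm.trans (starₗᵢ ℂ)

/-- In finite dimension `τ` is itself an element of the predual, and evaluation there is weak-*
continuous. The predual convention is conjugate-linear, which inserts a `star`; the hypothesis on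
`τ` moves it outside. -/
theorem continuous_finiteDimensionalPredual (τ : M →ₗ[ℂ] ℂ) (hτ : ∀ x, τ (star x) = star (τ x)) :
    Continuous fun f : WeakDual ℂ (finiteDimensionalPredual M).X =>
      τ ((finiteDimensionalPredual M).ofWeakDual f) := by
  let σ : StrongDual ℂ M := LinearMap.toContinuousLinearMap τ
  have h : (fun f : WeakDual ℂ (finiteDimensionalPredual M).X =>
      τ ((finiteDimensionalPredual M).ofWeakDual f)) =
      fun f : WeakDual ℂ (StrongDual ℂ M) => star (f σ) := by
    funext f
    obtain ⟨m, rfl⟩ := (doubleDualEquiv M).surjective f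
    have h1 : (finiteDimensionalPredual M).ofWeakDual (doubleDualEquiv M m) = star m :=
      congrArg star ((doubleDualEquiv M).symm_apply_apply m)
    exact (congrArg τ h1).trans (hτ m)
  rw [h]
  exact continuous_star.comp (WeakDual.eval_continuous σ)

theorem finiteDimensional_wStarAlgebra : WStarAlgebra M :=
  ⟨StrongDual ℂ M, inferInstance, inferInstance, inferInstance,
    ⟨(finiteDimensionalPredual M).equiv⟩⟩

end FiniteDimensional

theorem ntr_star (n : ℕ+) (x : Mat.{u} n) : ntr n (star x) = star (ntr n x) := by
  simp [ntr, Matrix.star_eq_conjTranspose, Matrix.trace_conjTranspose]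

/-- `M_n(ℂ)` as a tracial `W*`-algebra. -/
noncomputable abbrev matAlg (n : ℕ+) : TracialWStarAlgebra.{u} where
  carrier := Mat.{u} n
  wstar := finiteDimensional_wStarAlgebra _
  τ := ntr n
  nonneg x := by
    rw [ntr_star_mul_self]
    exact Complex.zero_le_real.2 (by positivity)
  unital := by
    have hn : ((n : ℕ) : ℂ) ≠ 0 := by exact_mod_cast n.ne_zero
    simp [ntr, hn]
  tracial x y := by
    simp [ntr, Matrix.trace_mul_comm x y]
  faithful x hx := by
    rw [ntr_star_mul_self] at hx
    have hn : (((n : ℕ) : ℝ)⁻¹) ≠ 0 := by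
      have : ((n : ℕ) : ℝ) ≠ 0 := by exact_mod_cast n.ne_zero
      exact inv_ne_zero this
    have h := (mul_eq_zero.1 (Complex.ofReal_eq_zero.1 hx)).resolve_left hn
    ext i j
    have h1 := (Finset.sum_eq_zero_iff_of_nonneg
      (fun j _ => Finset.sum_nonneg fun i _ => sq_nonneg ‖x i j‖)).1 h j (Finset.mem_univ j)
    have h2 := (Finset.sum_eq_zero_iff_of_nonneg
      (fun i _ => sq_nonneg ‖x i j‖)).1 h1 i (Finset.mem_univ i)
    simpa using h2
  normal := ⟨_, continuous_finiteDimensionalPredual _ (ntr n) (ntr_star n)⟩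

/-! ### Elementary facts on traces -/

namespace TracialWStarAlgebra

variable (M : TracialWStarAlgebra.{u})

/-- Positivity at `y + 1` and at `y` forces `τ(y*) + τ(y)` to be real; the cases `y = x` and `y =
ix` give the two coordinates. -/
theorem τ_star (x : M) : M.τ (star x) = star (M.τ x) := by
  have key : ∀ y : M, (M.τ (star y) + M.τ y).im = 0 := fun y => by
    have h := (Complex.le_def.1 (M.nonneg (y + 1))).2
    have h0 := (Complex.le_def.1 (M.nonneg y)).2
    have e : star (y + 1) * (y + 1) = star y * y + (star y + y) + 1 := by
      rw [star_add, star_one]; noncomm_ring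
    rw [e, map_add, map_add, map_add, M.unital] at h
    simp only [Complex.add_im, Complex.zero_im, Complex.one_im] at h h0 ⊢
    linarith
  have h1 := key x
  have h2 := key (Complex.I • x)
  rw [star_smul, map_smul, map_smul] at h2
  simp at h1 h2
  apply Complex.ext <;> simp <;> linarith

theorem norm₂_sq (x : M) : M.str.norm₂ x ^ 2 = (M.τ (star x * x)).re :=
  Real.sq_sqrt (Complex.le_def.1 (M.nonneg x)).1

theorem τ_star_mul_self (x : M) : M.τ (star x * x) = ((M.str.norm₂ x ^ 2 : ℝ) : ℂ) := by
  rw [norm₂_sq]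
  exact Complex.ext rfl (Complex.le_def.1 (M.nonneg x)).2.symm

theorem τ_nonneg_of_nonneg [PartialOrder M] [StarOrderedRing M] {x : M} (hx : 0 ≤ x) :
    0 ≤ M.τ x := by
  obtain ⟨y, rfl⟩ := CStarAlgebra.nonneg_iff_eq_star_mul_self.1 hx
  exact M.nonneg y

theorem norm₂_le_norm (x : M) : M.str.norm₂ x ≤ ‖x‖ := by
  let _ : PartialOrder M := CStarAlgebra.spectralOrder M
  have _ : StarOrderedRing M := CStarAlgebra.spectralOrderedRing M
  have h := M.τ_nonneg_of_nonneg
    (sub_nonneg.2 (IsSelfAdjoint.le_algebraMap_norm_self (IsSelfAdjoint.star_mul_self x)))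
  rw [map_sub, IsScalarTower.algebraMap_apply ℝ ℂ M, Algebra.algebraMap_eq_smul_one, map_smul, M.unital] at h
  have h1 := (Complex.le_def.1 h).1
  simp [CStarRing.norm_star_mul_self] at h1
  refine le_of_sq_le_sq ?_ (norm_nonneg x)
  rw [norm₂_sq]
  nlinarith

/-- The variance `‖x - τ(x)‖₂² = ‖x‖₂² - |τ(x)|²` is nonnegative. -/
theorem norm_τ_le_norm₂ (x : M) : ‖M.τ x‖ ≤ M.str.norm₂ x := by
  have h := (Complex.le_def.1 (M.nonneg (x - algebraMap ℂ M (M.τ x)))).1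
  have e : star (x - algebraMap ℂ M (M.τ x)) * (x - algebraMap ℂ M (M.τ x)) =
      star x * x - M.τ x • star x - star (M.τ x) • x + (M.τ x * star (M.τ x)) • 1 := by
    simp only [Algebra.algebraMap_eq_smul_one, star_sub, star_smul, star_one, sub_mul, mul_sub,
      smul_mul_assoc, mul_smul_comm, one_mul, mul_one, smul_smul, smul_sub]
    abel
  rw [e] at h
  simp only [map_sub, map_add, map_smul, M.unital, M.τ_star, M.τ_star_mul_self] at h
  refine le_of_sq_le_sq ?_ (Real.sqrt_nonneg _)
  simp [-Complex.ofReal_pow] at h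
  rw [Complex.sq_norm, Complex.normSq_apply]
  linarith

end TracialWStarAlgebra

/-! ### Connectives and an induction principle for formulas -/

/-- The negative of a formula. -/
def Formula.neg (φ : Formula) : Formula :=
  .conn (k := 1) ⟨fun v => -v 0, by fun_prop⟩ fun _ => φ

/-- No boundedness is required, because the real infimum is defined as minus the supremum of the
negatives, default values included. -/
theorem Formula.eval_inf (A : TracialStructure.{u}) (i : ℕ) (r : Set.Ioi (0 : ℝ)) (φ : Formula)
    (X : ℕ → A) : (Formula.inf i r φ).eval A X = ((Formula.sup i r φ.neg).neg).eval A X := by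
  have h := Real.sInf_def (Set.range fun a : A.D r => φ.eval A (Function.update X i a))
  rw [← Set.image_neg_eq_neg, ← Set.range_comp] at h
  exact h

/-- A term whose `Re tr` is `‖s - t‖₂²`. -/
def Term.sqDist (s t : Term) : Term :=
  .mul (.star (.add s (.smul (-1) t))) (.add s (.smul (-1) t))

theorem Term.eval_sqDist (A : TracialStructure.{u}) (s t : Term) (X : ℕ → A) :
    (s.sqDist t).eval A X =
      Star.star (s.eval A X - t.eval A X) * (s.eval A X - t.eval A X) := by
  simp [Term.sqDist, Term.eval, sub_eq_add_neg]

/-- Up to equality of interpretations, all formulas are built from `Re tr(t)` by connectives and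
suprema. -/
theorem Formula.induction_eval {P : Formula → Prop} (reTr : ∀ t, P (.reTr t))
    (conn : ∀ {k : ℕ} (F : C(Fin k → ℝ, ℝ)) (φ : Fin k → Formula), (∀ l, P (φ l)) → P (.conn F φ))
    (sup : ∀ i r φ, P φ → P (.sup i r φ))
    (congr : ∀ φ ψ : Formula, (∀ (A : TracialStructure.{u}) (X : ℕ → A),
      φ.eval A X = ψ.eval A X) → P φ → P ψ) (φ : Formula) : P φ := by
  have neg : ∀ φ, P φ → P φ.neg := fun φ h => conn _ _ fun _ => h
  induction φ with
  | reTr t => exact reTr t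
  | imTr t =>
    refine congr _ _ (fun A X => ?_) (reTr (.smul (-Complex.I) t))
    simp [Formula.eval, Term.eval]
  | dist s t =>
    refine congr _ _ (fun A X => ?_)
      (conn (k := 1) ⟨fun v => √(v 0), by fun_prop⟩ (fun _ => .reTr (s.sqDist t)) fun _ => reTr _)
    simp only [Formula.eval, Term.eval_sqDist]
    rfl
  | conn F φ ih => exact conn F φ ih
  | sup i r φ ih => exact sup i r φ ih
  | inf i r φ ih => exact congr _ _ (fun A X => (eval_inf A i r φ X).symm) (neg _ (sup _ _ _ (neg _ ih)))

/-! ### Uniform bounds -/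

theorem Term.exists_norm_le (t : Term) (r : ℕ → ℝ) :
    ∃ C : ℝ, 0 ≤ C ∧ ∀ (M : TracialWStarAlgebra.{u}) (X : ℕ → M), (∀ j, ‖X j‖ ≤ r j) →
      ‖t.eval M.str X‖ ≤ C := by
  induction t with
  | var i => exact ⟨|r i|, abs_nonneg _, fun M X hX => (hX i).trans (le_abs_self _)⟩
  | zero => exact ⟨0, le_rfl, fun M X hX => norm_zero.le⟩
  | one =>
    refine ⟨1, zero_le_one, fun M X hX => ?_⟩
    rcases subsingleton_or_nontrivial M with h | h
    · exact (norm_of_subsingleton _).trans_le zero_le_one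
    · exact CStarRing.norm_one.le
  | add s t hs ht =>
    obtain ⟨C, hC, h⟩ := hs
    obtain ⟨C', hC', h'⟩ := ht
    exact ⟨C + C', by positivity, fun M X hX =>
      (norm_add_le _ _).trans (add_le_add (h M X hX) (h' M X hX))⟩
  | mul s t hs ht =>
    obtain ⟨C, hC, h⟩ := hs
    obtain ⟨C', hC', h'⟩ := ht
    exact ⟨C * C', by positivity, fun M X hX =>
      (norm_mul_le _ _).trans (mul_le_mul (h M X hX) (h' M X hX) (norm_nonneg _) hC)⟩
  | star t ht =>
    obtain ⟨C, hC, h⟩ := ht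
    exact ⟨C, hC, fun M X hX => (norm_star _).trans_le (h M X hX)⟩
  | smul c t ht =>
    obtain ⟨C, hC, h⟩ := ht
    exact ⟨‖c‖ * C, by positivity, fun M X hX =>
      (norm_smul _ _).trans_le (mul_le_mul_of_nonneg_left (h M X hX) (norm_nonneg _))⟩

theorem abs_ciSup_le {ι : Type*} [Nonempty ι] {f : ι → ℝ} {C : ℝ} (h : ∀ i, |f i| ≤ C) :
    |⨆ i, f i| ≤ C := by
  obtain ⟨i⟩ := ‹Nonempty ι›
  have hb : BddAbove (Set.range f) := ⟨C, by rintro _ ⟨i, rfl⟩; exact (abs_le.1 (h i)).2⟩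
  exact abs_le.2 ⟨(abs_le.1 (h i)).1.trans (le_ciSup hb i), ciSup_le fun i => (abs_le.1 (h i)).2⟩

theorem norm_update_le {E : Type*} [Norm E] {X : ℕ → E} {r : ℕ → ℝ} {i : ℕ} {a : E} {s : ℝ}
    (hX : ∀ j, ‖X j‖ ≤ r j) (ha : ‖a‖ ≤ s) (j : ℕ) :
    ‖Function.update X i a j‖ ≤ Function.update r i s j := by
  rcases eq_or_ne j i with rfl | h
  · simpa using ha
  · simpa [h] using hX j

theorem TracialWStarAlgebra.zero_mem_D (M : TracialWStarAlgebra.{u}) {r : ℝ} (hr : 0 < r) :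
    (0 : M) ∈ M.str.D r :=
  norm_zero.trans_le hr.le

/-- The bound is uniform over all tracial `W*`-algebras. It guards real suprema against their
default value and lets bounds survive the passage to the ultraproduct. -/
theorem Formula.exists_abs_eval_le (φ : Formula) : ∀ r : ℕ → ℝ,
    ∃ C : ℝ, ∀ (M : TracialWStarAlgebra.{u}) (X : ℕ → M), (∀ j, ‖X j‖ ≤ r j) →
      |φ.eval M.str X| ≤ C := by
  induction φ using Formula.induction_eval.{u} with
  | reTr t =>
    intro r
    obtain ⟨C, -, h⟩ := t.exists_norm_le r
    exact ⟨C, fun M X hX => (Complex.abs_re_le_norm _).trans ((M.norm_τ_le_norm₂ _).trans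
      ((M.norm₂_le_norm _).trans (h M X hX)))⟩
  | conn F φ ih =>
    intro r
    choose C hC using fun l => ih l r
    obtain ⟨B, hB⟩ := ((isCompact_univ_pi fun l => isCompact_Icc (a := -C l) (b := C l)).image
      F.continuous).isBounded.exists_norm_le
    exact ⟨B, fun M X hX => hB _ ⟨_, fun l _ => abs_le.1 (hC l M X hX), rfl⟩⟩
  | sup i s φ ih =>
    intro r
    obtain ⟨C, hC⟩ := ih (Function.update r i s)
    refine ⟨C, fun M X hX => ?_⟩
    have : Nonempty (M.str.D s) := ⟨0, M.zero_mem_D s.2⟩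
    exact abs_ciSup_le fun a => hC M _ (norm_update_le hX a.2)
  | congr φ ψ h ih =>
    intro r
    obtain ⟨C, hC⟩ := ih r
    exact ⟨C, fun M X hX => (h M.str X) ▸ hC M X hX⟩

/-! ### A countable family of formulas that approximates all formulas -/

/-- The closure consists of the values of finite trees whose nodes carry operations from `𝒪`; there
are countably many such trees. -/
theorem exists_countable_closed {α : Type*} (𝒪 : Set (Σ k : ℕ, (Fin k → α) → α))
    (h𝒪 : 𝒪.Countable) :
    ∃ S : Set α, S.Countable ∧ ∀ o ∈ 𝒪, ∀ v : Fin o.1 → α, (∀ l, v l ∈ S) → o.2 v ∈ S := by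
  have := h𝒪.toEncodable
  let e : WType (fun o : 𝒪 => Fin o.1.1) → α := WType.elim α fun p => p.1.1.2 p.2
  refine ⟨Set.range e, Set.countable_range e, fun o ho v hv => ?_⟩
  choose w hw using hv
  refine ⟨WType.mk ⟨o, ho⟩ w, ?_⟩
  change o.2 (fun l => e (w l)) = o.2 v
  simp only [hw]

theorem exists_countable_terms : ∃ S : Set Term, S.Countable ∧ (∀ i, .var i ∈ S) ∧ .zero ∈ S ∧
    .one ∈ S ∧ (∀ s ∈ S, ∀ t ∈ S, .add s t ∈ S) ∧ (∀ s ∈ S, ∀ t ∈ S, .mul s t ∈ S) ∧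
    (∀ t ∈ S, .star t ∈ S) ∧
    ∃ D : Set ℂ, Dense D ∧ ∀ c ∈ D, ∀ t ∈ S, .smul c t ∈ S := by
  obtain ⟨D, hD, hD'⟩ := TopologicalSpace.exists_countable_dense ℂ
  obtain ⟨S, hS, h⟩ := exists_countable_closed (α := Term)
    ((Set.range fun i : ℕ => ⟨0, fun _ => .var i⟩) ∪ {⟨0, fun _ => .zero⟩, ⟨0, fun _ => .one⟩,
      ⟨2, fun v => .add (v 0) (v 1)⟩, ⟨2, fun v => .mul (v 0) (v 1)⟩, ⟨1, fun v => .star (v 0)⟩} ∪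
      ((fun c => ⟨1, fun v => .smul c (v 0)⟩) '' D))
    (((Set.countable_range _).union (Set.toFinite _).countable).union (hD.image _))
  refine ⟨S, hS, fun i => h ⟨0, fun _ => .var i⟩ (by simp) ![] (by simp),
    h ⟨0, fun _ => .zero⟩ (by simp) ![] (by simp), h ⟨0, fun _ => .one⟩ (by simp) ![] (by simp),
    fun s hs t ht => h ⟨2, fun v => .add (v 0) (v 1)⟩ (by simp) ![s, t] ?_,
    fun s hs t ht => h ⟨2, fun v => .mul (v 0) (v 1)⟩ (by simp) ![s, t] ?_,
    fun t ht => h ⟨1, fun v => .star (v 0)⟩ (by simp) ![t] ?_, D, hD',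
    fun c hc t ht => h ⟨1, fun v => .smul c (v 0)⟩ (Or.inr ⟨c, hc, rfl⟩) ![t] ?_⟩
  · simp [Fin.forall_fin_two, hs, ht]
  · simp [Fin.forall_fin_two, hs, ht]
  · simpa using ht
  · simpa using ht

/-- The rescaling `c` serves the quantifiers: a supremum over `D_s` becomes one over `D_1` after
`x_i` is replaced by `s x_i`, so that radius 1 suffices in the countable family of formulas. -/
theorem exists_countable_terms_approx : ∃ S : Set Term, S.Countable ∧
    ∀ (t : Term) (c : ℕ → ℂ) (r : ℕ → ℝ) (ε : ℝ), 0 < ε → ∃ s ∈ S,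
      ∀ (M : TracialWStarAlgebra.{u}) (X : ℕ → M), (∀ j, ‖X j‖ ≤ r j) →
        ‖t.eval M.str (fun j => c j • X j) - s.eval M.str X‖ ≤ ε := by
  obtain ⟨S, hS, hvar, hzero, hone, hadd, hmul, hstar, D, hD, hsmul⟩ := exists_countable_terms
  refine ⟨S, hS, fun t c r => ?_⟩
  have hc : ∀ (M : TracialWStarAlgebra.{u}) (X : ℕ → M), (∀ j, ‖X j‖ ≤ r j) →
      ∀ j, ‖c j • X j‖ ≤ ‖c j‖ * r j := fun M X hX j =>
    (norm_smul _ _).trans_le (mul_le_mul_of_nonneg_left (hX j) (norm_nonneg _))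
  have hscalar : ∀ (c : ℂ) (B ε : ℝ), 0 ≤ B → 0 < ε → ∃ d ∈ D, ‖c - d‖ * B ≤ ε := by
    intro c B ε hB hε
    obtain ⟨d, hd, h⟩ := hD.exists_dist_lt c (ε := ε / (B + 1)) (by positivity)
    refine ⟨d, hd, ?_⟩
    rw [dist_eq_norm, lt_div_iff₀ (by positivity)] at h
    nlinarith [norm_nonneg (c - d)]
  induction t with
  | var i =>
    intro ε hε
    obtain ⟨d, hd, h⟩ := hscalar (c i) |r i| ε (abs_nonneg _) hε
    refine ⟨.smul d (.var i), hsmul d hd _ (hvar i), fun M X hX => ?_⟩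
    simp only [Term.eval, ← sub_smul, norm_smul]
    exact (mul_le_mul_of_nonneg_left ((hX i).trans (le_abs_self _)) (norm_nonneg _)).trans h
  | zero => exact fun ε hε => ⟨_, hzero, fun M X hX => by simpa [Term.eval] using hε.le⟩
  | one => exact fun ε hε => ⟨_, hone, fun M X hX => by simpa [Term.eval] using hε.le⟩
  | add s t hs ht =>
    intro ε hε
    obtain ⟨s', hs', h⟩ := hs (ε / 2) (by positivity)
    obtain ⟨t', ht', h'⟩ := ht (ε / 2) (by positivity)
    refine ⟨_, hadd s' hs' t' ht', fun M X hX => ?_⟩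
    simp only [Term.eval, add_sub_add_comm]
    linarith [norm_add_le_of_le (h M X hX) (h' M X hX)]
  | mul s t hs ht =>
    intro ε hε
    obtain ⟨C, hC, hb⟩ := s.exists_norm_le.{u} fun j => ‖c j‖ * r j
    obtain ⟨C', hC', hb'⟩ := t.exists_norm_le.{u} fun j => ‖c j‖ * r j
    -- The product error expands into two linear terms, at most `C δ` and `δ C'`, and a quadratic
    -- one, at most `δ` because `δ ≤ 1`.
    obtain ⟨δ, hδ, hδ1, hδε⟩ : ∃ δ : ℝ, 0 < δ ∧ δ ≤ 1 ∧ δ * (C + C' + 1) ≤ ε :=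
      ⟨min 1 (ε / (C + C' + 1)), by positivity, min_le_left _ _,
        (le_div_iff₀ (by positivity)).1 (min_le_right _ _)⟩
    obtain ⟨s', hs', h⟩ := hs δ hδ
    obtain ⟨t', ht', h'⟩ := ht δ hδ
    refine ⟨_, hmul s' hs' t' ht', fun M X hX => ?_⟩
    simp only [Term.eval]
    have h1 := hb M _ (hc M X hX)
    have h2 := hb' M _ (hc M X hX)
    have h3 := h M X hX
    have h4 := h' M X hX
    set x := s.eval M.str fun j => c j • X j
    set y := t.eval M.str fun j => c j • X j
    set x' := s'.eval M.str X
    set y' := t'.eval M.str X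
    have e : x * y - x' * y' = x * (y - y') + (x - x') * y - (x - x') * (y - y') := by
      noncomm_ring
    rw [e]
    calc _ ≤ ‖x * (y - y')‖ + ‖(x - x') * y‖ + ‖(x - x') * (y - y')‖ :=
          (norm_sub_le _ _).trans (add_le_add (norm_add_le _ _) le_rfl)
      _ ≤ C * δ + δ * C' + δ * 1 := by
          gcongr
          · exact (norm_mul_le _ _).trans (mul_le_mul h1 h4 (norm_nonneg _) hC)
          · exact (norm_mul_le _ _).trans (mul_le_mul h3 h2 (norm_nonneg _) hδ.le)
          · exact (norm_mul_le _ _).trans (mul_le_mul h3 (h4.trans hδ1) (norm_nonneg _) hδ.le)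
      _ ≤ ε := by linarith
  | star t ht =>
    intro ε hε
    obtain ⟨t', ht', h'⟩ := ht ε hε
    refine ⟨_, hstar t' ht', fun M X hX => ?_⟩
    simp only [Term.eval, ← star_sub, norm_star]
    exact h' M X hX
  | smul a t ht =>
    intro ε hε
    obtain ⟨C, hC, hb⟩ := t.exists_norm_le.{u} fun j => ‖c j‖ * r j
    obtain ⟨d, hd, h⟩ := hscalar a C (ε / 2) hC (by positivity)
    obtain ⟨t', ht', h'⟩ := ht (ε / 2 / (‖d‖ + 1)) (by positivity)
    refine ⟨_, hsmul d hd t' ht', fun M X hX => ?_⟩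
    simp only [Term.eval]
    have h2 := hb M _ (hc M X hX)
    have h4 := h' M X hX
    set y := t.eval M.str fun j => c j • X j
    set y' := t'.eval M.str X
    have e : a • y - d • y' = (a - d) • y + d • (y - y') := by
      rw [sub_smul, smul_sub]; abel
    rw [e]
    refine (norm_add_le _ _).trans ?_
    rw [norm_smul, norm_smul]
    have h5 : ‖d‖ * ‖y - y'‖ ≤ ε / 2 := by
      rw [le_div_iff₀ (by positivity)] at h4
      nlinarith [norm_nonneg (y - y')]
    linarith [mul_le_mul_of_nonneg_left h2 (norm_nonneg (a - d))]

theorem abs_ciSup_sub_ciSup_le {ι : Type*} [Nonempty ι] {f g : ι → ℝ} {C C' ε : ℝ}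
    (hf : ∀ i, |f i| ≤ C) (hg : ∀ i, |g i| ≤ C') (h : ∀ i, |f i - g i| ≤ ε) :
    |(⨆ i, f i) - ⨆ i, g i| ≤ ε := by
  have hbf : BddAbove (Set.range f) := ⟨C, by rintro _ ⟨i, rfl⟩; exact (abs_le.1 (hf i)).2⟩
  have hbg : BddAbove (Set.range g) := ⟨C', by rintro _ ⟨i, rfl⟩; exact (abs_le.1 (hg i)).2⟩
  have h1 : (⨆ i, f i) ≤ (⨆ i, g i) + ε := ciSup_le fun i => by
    linarith [(abs_le.1 (h i)).2, le_ciSup hbg i]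
  have h2 : (⨆ i, g i) ≤ (⨆ i, f i) + ε := ciSup_le fun i => by
    linarith [(abs_le.1 (h i)).1, le_ciSup hbf i]
  exact abs_le.2 ⟨by linarith, by linarith⟩

theorem exists_countable_formulas : ∃ S : Set Formula, S.Countable ∧
    (∃ T : Set Term, (∀ t ∈ T, .reTr t ∈ S) ∧
      ∀ (t : Term) (c : ℕ → ℂ) (r : ℕ → ℝ) (ε : ℝ), 0 < ε → ∃ s ∈ T,
        ∀ (M : TracialWStarAlgebra.{u}) (X : ℕ → M), (∀ j, ‖X j‖ ≤ r j) →
          ‖t.eval M.str (fun j => c j • X j) - s.eval M.str X‖ ≤ ε) ∧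
    (∀ k : ℕ, ∃ D : Set C(Fin k → ℝ, ℝ), Dense D ∧
      ∀ F ∈ D, ∀ φ : Fin k → Formula, (∀ l, φ l ∈ S) → .conn F φ ∈ S) ∧
    ∀ i, ∀ φ ∈ S, .sup i ⟨1, Set.mem_Ioi.2 zero_lt_one⟩ φ ∈ S := by
  obtain ⟨T, hT, hT'⟩ := exists_countable_terms_approx.{u}
  choose D hD hD' using fun k : ℕ => TopologicalSpace.exists_countable_dense C(Fin k → ℝ, ℝ)
  obtain ⟨S, hS, h⟩ := exists_countable_closed (α := Formula)
    (((fun t => ⟨0, fun _ => .reTr t⟩) '' T) ∪ (⋃ k, (fun F => ⟨k, fun v => .conn F v⟩) '' D k) ∪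
      Set.range fun i : ℕ => ⟨1, fun v => .sup i ⟨1, Set.mem_Ioi.2 zero_lt_one⟩ (v 0)⟩)
    (((hT.image _).union (Set.countable_iUnion fun k => (hD k).image _)).union
      (Set.countable_range _))
  refine ⟨S, hS, ⟨T, fun t ht => ?_, hT'⟩, fun k => ⟨D k, hD' k, fun F hF φ hφ => ?_⟩,
    fun i φ hφ => ?_⟩
  · exact h ⟨0, fun _ => .reTr t⟩ (Or.inl (Or.inl ⟨t, ht, rfl⟩)) ![] (by simp)
  · exact h ⟨k, fun v => .conn F v⟩ (Or.inl (Or.inr (Set.mem_iUnion.2 ⟨k, F, hF, rfl⟩))) φ hφ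
  · exact h ⟨1, fun v => .sup i ⟨1, Set.mem_Ioi.2 zero_lt_one⟩ (v 0)⟩ (Or.inr ⟨i, rfl⟩) (fun _ => φ)
      fun _ => hφ

/-- Convergence in the compact-open topology is uniform convergence on compact sets. -/
theorem exists_dense_approx {k : ℕ} {D : Set C(Fin k → ℝ, ℝ)} (hD : Dense D)
    (F : C(Fin k → ℝ, ℝ)) {K : Set (Fin k → ℝ)} (hK : IsCompact K) {ε : ℝ} (hε : 0 < ε) :
    ∃ G ∈ D, ∀ x ∈ K, |F x - G x| < ε := by
  have h := (ContinuousMap.tendsto_iff_forall_isCompact_tendstoUniformlyOn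
    (F := fun G : C(Fin k → ℝ, ℝ) => G) (p := 𝓝 F)).1 tendsto_id K hK
  obtain ⟨G, hG, hG'⟩ := ((mem_closure_iff_frequently.1 (hD F)).and_eventually
    (Metric.tendstoUniformlyOn_iff.1 h ε hε)).exists
  exact ⟨G, hG, hG'⟩

theorem TracialWStarAlgebra.iSup_D_eq (M : TracialWStarAlgebra.{u}) {s : ℝ} (hs : 0 < s)
    (f : M → ℝ) : (⨆ a : M.str.D s, f a) = ⨆ b : M.str.D 1, f ((s : ℂ) • (b : M)) := by
  have hn : ‖(s : ℂ)‖ = s := by simp [abs_of_pos hs]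
  have hmem : ∀ b : M.str.D 1, (s : ℂ) • (b : M) ∈ M.str.D s := fun b => by
    change ‖(s : ℂ) • (b : M)‖ ≤ s
    rw [norm_smul, hn]
    exact mul_le_of_le_one_right hs.le b.2
  have hsurj : Function.Surjective fun b : M.str.D 1 => (⟨_, hmem b⟩ : M.str.D s) := by
    rintro ⟨a, ha⟩
    have hs0 : (s : ℂ) ≠ 0 := by exact_mod_cast hs.ne'
    refine ⟨⟨(s : ℂ)⁻¹ • a, ?_⟩, Subtype.ext (smul_inv_smul₀ hs0 a)⟩
    change ‖(s : ℂ)⁻¹ • a‖ ≤ 1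
    rw [norm_smul, norm_inv, hn]
    exact (inv_mul_le_one₀ hs).2 ha
  exact (hsurj.iSup_comp (g := fun a : M.str.D s => f a)).symm

/-- A countable set of formulas approximates all formulas, uniformly on products of domains in all
tracial `W*`-algebras. -/
theorem exists_countable_formulas_approx : ∃ S : Set Formula, S.Countable ∧
    ∀ (φ : Formula) (c : ℕ → ℂ) (r : ℕ → ℝ) (ε : ℝ), 0 < ε → ∃ ψ ∈ S,
      ∀ (M : TracialWStarAlgebra.{u}) (X : ℕ → M), (∀ j, ‖X j‖ ≤ r j) →
        |φ.eval M.str (fun j => c j • X j) - ψ.eval M.str X| ≤ ε := by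
  obtain ⟨S, hS, ⟨T, hT, hT'⟩, hconn, hsup⟩ := exists_countable_formulas.{u}
  have hc : ∀ (c : ℕ → ℂ) (r : ℕ → ℝ) (M : TracialWStarAlgebra.{u}) (X : ℕ → M),
      (∀ j, ‖X j‖ ≤ r j) → ∀ j, ‖c j • X j‖ ≤ ‖c j‖ * r j := fun c r M X hX j =>
    (norm_smul _ _).trans_le (mul_le_mul_of_nonneg_left (hX j) (norm_nonneg _))
  refine ⟨S, hS, fun φ => ?_⟩
  induction φ using Formula.induction_eval.{u} with
  | reTr t =>
    intro c r ε hε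
    obtain ⟨s, hs, h⟩ := hT' t c r ε hε
    refine ⟨_, hT s hs, fun M X hX => ?_⟩
    simp only [Formula.eval, ← Complex.sub_re, ← map_sub]
    exact (Complex.abs_re_le_norm _).trans ((M.norm_τ_le_norm₂ _).trans
      ((M.norm₂_le_norm _).trans (h M X hX)))
  | @conn k F φ ih =>
    intro c r ε hε
    choose C hC using fun l => (φ l).exists_abs_eval_le.{u} fun j => ‖c j‖ * r j
    -- The margin 1 keeps the values of the approximating formulas, which are within 1, inside the
    -- compact set where `G` approximates `F`.
    let K : Set (Fin k → ℝ) := Set.univ.pi fun l => Set.Icc (-C l - 1) (C l + 1)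
    have hK : IsCompact K := isCompact_univ_pi fun l => isCompact_Icc
    obtain ⟨δ, hδ, hF⟩ := Metric.uniformContinuousOn_iff.1
      (hK.uniformContinuousOn_of_continuous F.continuous.continuousOn) (ε / 2) (by positivity)
    obtain ⟨D, hD, hDS⟩ := hconn k
    obtain ⟨G, hG, hG'⟩ := exists_dense_approx hD F hK (half_pos hε)
    choose ψ hψ hψ' using fun l => ih l c r (min 1 (δ / 2)) (by positivity)
    refine ⟨_, hDS G hG ψ hψ, fun M X hX => ?_⟩
    simp only [Formula.eval]
    set y := fun l => (φ l).eval M.str fun j => c j • X j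
    set z := fun l => (ψ l).eval M.str X
    have hy : ∀ l, |y l| ≤ C l := fun l => hC l M _ (hc c r M X hX)
    have hyz : ∀ l, |y l - z l| ≤ min 1 (δ / 2) := fun l => hψ' l M X hX
    have hyK : y ∈ K := fun l _ =>
      ⟨by linarith [(abs_le.1 (hy l)).1], by linarith [(abs_le.1 (hy l)).2]⟩
    have hzK : z ∈ K := fun l _ => by
      have h1 := abs_le.1 (hy l)
      have h2 := abs_le.1 ((hyz l).trans (min_le_left _ _))
      exact ⟨by linarith, by linarith⟩
    have h1 := hF y hyK z hzK ((dist_pi_lt_iff hδ).2 fun l =>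
      ((hyz l).trans (min_le_right _ _)).trans_lt (half_lt_self hδ))
    rw [Real.dist_eq] at h1
    linarith [abs_sub_le (F y) (F z) (G z), hG' z hzK]
  | sup i s φ ih =>
    intro c r ε hε
    -- The bound variable is rescaled by the quantifier radius `s` and then ranges over the unit
    -- ball; its former scale and radius are irrelevant.
    obtain ⟨ψ, hψ, h⟩ := ih (Function.update c i ((s : ℝ) : ℂ)) (Function.update r i 1) ε hε
    refine ⟨_, hsup i ψ hψ, fun M X hX => ?_⟩
    have hne : Nonempty (M.str.D 1) := ⟨0, M.zero_mem_D zero_lt_one⟩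
    obtain ⟨C, hC⟩ := φ.exists_abs_eval_le.{u} fun j => ‖Function.update c i ((s : ℝ) : ℂ) j‖ *
      Function.update r i 1 j
    obtain ⟨C', hC'⟩ := ψ.exists_abs_eval_le.{u} (Function.update r i 1)
    have e : ∀ b : M, Function.update (fun j => c j • X j) i (((s : ℝ) : ℂ) • b) =
        fun j => Function.update c i ((s : ℝ) : ℂ) j • Function.update X i b j := fun b => by
      funext j
      rcases eq_or_ne j i with rfl | hj
      · simp
      · simp [hj]
    simp only [Formula.eval]
    rw [M.iSup_D_eq s.2 fun a => φ.eval M.str (Function.update (fun j => c j • X j) i a)]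
    simp only [e]
    have hb : ∀ b : M.str.D 1, ∀ j, ‖Function.update X i (b : M) j‖ ≤ Function.update r i 1 j :=
      fun b => norm_update_le hX b.2
    exact abs_ciSup_sub_ciSup_le (fun b => hC M _ (hc _ _ M _ (hb b))) (fun b => hC' M _ (hb b))
      fun b => h M _ (hb b)
  | congr φ φ' h ih =>
    intro c r ε hε
    obtain ⟨ψ, hψ, h'⟩ := ih c r ε hε
    exact ⟨ψ, hψ, fun M X hX => (h M.str _) ▸ h' M X hX⟩

/-! ### Free variables -/

theorem Term.eval_congr (A : TracialStructure.{u}) (t : Term) {X Y : ℕ → A}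
    (h : ∀ i ∈ t.vars, X i = Y i) : t.eval A X = t.eval A Y := by
  induction t with
  | var i => exact h i rfl
  | zero => rfl
  | one => rfl
  | add s t hs ht =>
    exact congrArg₂ (· + ·) (hs fun i hi => h i (Or.inl hi)) (ht fun i hi => h i (Or.inr hi))
  | mul s t hs ht =>
    exact congrArg₂ (· * ·) (hs fun i hi => h i (Or.inl hi)) (ht fun i hi => h i (Or.inr hi))
  | star t ht => exact congrArg _ (ht h)
  | smul c t ht => exact congrArg _ (ht h)

theorem Formula.eval_congr (A : TracialStructure.{u}) (φ : Formula) {X Y : ℕ → A}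
    (h : ∀ i ∈ φ.freeVars, X i = Y i) : φ.eval A X = φ.eval A Y := by
  have upd : ∀ {φ : Formula} {i : ℕ} {X Y : ℕ → A}, (∀ j ∈ φ.freeVars \ {i}, X j = Y j) →
      ∀ a, ∀ j ∈ φ.freeVars, Function.update X i a j = Function.update Y i a j := by
    intro φ i X Y h a j hj
    rcases eq_or_ne j i with rfl | hji
    · simp
    · simpa [hji] using h j ⟨hj, hji⟩
  induction φ generalizing X Y with
  | reTr t => simp only [Formula.eval, t.eval_congr A h]
  | imTr t => simp only [Formula.eval, t.eval_congr A h]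
  | dist s t =>
    simp only [Formula.eval, s.eval_congr A fun i hi => h i (Or.inl hi),
      t.eval_congr A fun i hi => h i (Or.inr hi)]
  | conn F φ ih =>
    exact congrArg F (funext fun l => ih l fun i hi => h i (Set.mem_iUnion.2 ⟨l, hi⟩))
  | sup i r φ ih => exact iSup_congr fun a => ih (upd h a)
  | inf i r φ ih => exact iInf_congr fun a => ih (upd h a)

theorem Term.finite_vars (t : Term) : t.vars.Finite := by
  induction t with
  | var i => exact Set.finite_singleton i
  | zero => exact Set.finite_empty
  | one => exact Set.finite_empty
  | add s t hs ht => exact hs.union ht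
  | mul s t hs ht => exact hs.union ht
  | star t ht => exact ht
  | smul c t ht => exact ht

theorem Formula.finite_freeVars (φ : Formula) : φ.freeVars.Finite := by
  induction φ with
  | reTr t => exact t.finite_vars
  | imTr t => exact t.finite_vars
  | dist s t => exact s.finite_vars.union t.finite_vars
  | conn F φ ih => exact Set.finite_iUnion ih
  | sup i r φ ih => exact ih.subset Set.sdiff_subset
  | inf i r φ ih => exact ih.subset Set.sdiff_subset

/-! ### Renaming of variables -/

/-- Renaming of the variables of a term. -/
def Term.rename (f : ℕ → ℕ) : Term → Term
  | .var i => .var (f i)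
  | .zero => .zero
  | .one => .one
  | .add s t => .add (s.rename f) (t.rename f)
  | .mul s t => .mul (s.rename f) (t.rename f)
  | .star t => .star (t.rename f)
  | .smul c t => .smul c (t.rename f)

/-- Renaming of all variables of a formula, free or bound. -/
def Formula.rename (f : ℕ → ℕ) : Formula → Formula
  | .reTr t => .reTr (t.rename f)
  | .imTr t => .imTr (t.rename f)
  | .dist s t => .dist (s.rename f) (t.rename f)
  | .conn F φ => .conn F fun l => (φ l).rename f
  | .sup i r φ => .sup (f i) r (φ.rename f)
  | .inf i r φ => .inf (f i) r (φ.rename f)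

theorem Term.eval_rename (A : TracialStructure.{u}) (f : ℕ → ℕ) (t : Term) (X : ℕ → A) :
    (t.rename f).eval A X = t.eval A (X ∘ f) := by
  induction t <;> simp_all [Term.rename, Term.eval]

theorem Formula.eval_rename (A : TracialStructure.{u}) {f : ℕ → ℕ} (hf : f.Injective)
    (φ : Formula) (X : ℕ → A) : (φ.rename f).eval A X = φ.eval A (X ∘ f) := by
  induction φ generalizing X <;>
    simp_all [Formula.rename, Formula.eval, Term.eval_rename,
      Function.update_comp_eq_of_injective]

/-! ### Infima over finitely many variables -/

/-- The infimum of a formula over the variables in a list, with radii `r`. -/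
def Formula.infList (r : ℕ → Set.Ioi (0 : ℝ)) (φ : Formula) : List ℕ → Formula
  | [] => φ
  | i :: L => .inf i (r i) (φ.infList r L)

theorem Formula.freeVars_infList (r : ℕ → Set.Ioi (0 : ℝ)) (φ : Formula) (L : List ℕ) :
    (φ.infList r L).freeVars = φ.freeVars \ {i | i ∈ L} := by
  induction L with
  | nil => simp [infList]
  | cons i L ih =>
    ext j
    simp only [infList, freeVars, ih, Set.mem_sdiff, Set.mem_ofPred_eq, List.mem_cons,
      Set.mem_singleton_iff]
    tauto

theorem Formula.infList_nonneg {A : TracialStructure.{u}} {r : ℕ → Set.Ioi (0 : ℝ)} {φ : Formula}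
    (hφ : ∀ X, 0 ≤ φ.eval A X) (L : List ℕ) (X : ℕ → A) : 0 ≤ (φ.infList r L).eval A X := by
  induction L generalizing X with
  | nil => exact hφ X
  | cons i L ih => exact Real.iInf_nonneg fun a => ih _

/-- Nonnegativity supplies the lower bound without which a real infimum could take its default value
0. -/
theorem Formula.infList_le {A : TracialStructure.{u}} {r : ℕ → Set.Ioi (0 : ℝ)} {φ : Formula}
    (hφ : ∀ X, 0 ≤ φ.eval A X) (L : List ℕ) (X : ℕ → A) (hX : ∀ j ∈ L, X j ∈ A.D (r j)) :
    (φ.infList r L).eval A X ≤ φ.eval A X := by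
  induction L with
  | nil => exact le_rfl
  | cons i L ih =>
    refine le_trans ?_ (ih fun j hj => hX j (List.mem_cons_of_mem _ hj))
    have hb : BddBelow (Set.range fun a : A.D (r i) =>
        (φ.infList r L).eval A (Function.update X i a)) :=
      ⟨0, by rintro _ ⟨a, rfl⟩; exact infList_nonneg hφ L _⟩
    refine (ciInf_le hb ⟨X i, hX i List.mem_cons_self⟩).trans_eq ?_
    rw [Function.update_eq_self]

theorem Formula.exists_lt_of_infList_lt {A : TracialStructure.{u}} {r : ℕ → Set.Ioi (0 : ℝ)}
    {φ : Formula} {ε : ℝ} (hD : ∀ j, (A.D (r j)).Nonempty) (L : List ℕ) (X : ℕ → A)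
    (h : (φ.infList r L).eval A X < ε) :
    ∃ Y : ℕ → A, (∀ j ∉ L, Y j = X j) ∧ (∀ j ∈ L, Y j ∈ A.D (r j)) ∧ φ.eval A Y < ε := by
  induction L generalizing X with
  | nil => exact ⟨X, fun _ _ => rfl, by simp, h⟩
  | cons i L ih =>
    -- An infimum over an empty domain would be 0 and would give no witness.
    have := (hD i).to_subtype
    obtain ⟨a, ha⟩ := exists_lt_of_ciInf_lt h
    obtain ⟨Y, hY, hY', hlt⟩ := ih _ ha
    refine ⟨Y, fun j hj => ?_, fun j hj => ?_, hlt⟩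
    · rw [List.mem_cons, not_or] at hj
      rw [hY j hj.2, Function.update_of_ne hj.1]
    · by_cases hjL : j ∈ L
      · exact hY' j hjL
      · obtain rfl := (List.mem_cons.1 hj).resolve_right hjL
        rw [hY j hjL, Function.update_self]
        exact a.2

/-- The formula `∑ |φ_l - v_l|`. -/
def Formula.sumDist {k : ℕ} (φ : Fin k → Formula) (v : Fin k → ℝ) : Formula :=
  .conn ⟨fun w => ∑ l, |w l - v l|, by fun_prop⟩ φ

theorem Formula.eval_sumDist (A : TracialStructure.{u}) {k : ℕ} (φ : Fin k → Formula)
    (v : Fin k → ℝ) (X : ℕ → A) :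
    (sumDist φ v).eval A X = ∑ l, |(φ l).eval A X - v l| := rfl

theorem Formula.sumDist_nonneg (A : TracialStructure.{u}) {k : ℕ} (φ : Fin k → Formula)
    (v : Fin k → ℝ) (X : ℕ → A) : 0 ≤ (sumDist φ v).eval A X :=
  (Finset.sum_nonneg fun _ _ => abs_nonneg _).trans_eq (eval_sumDist A φ v X).symm

/-! ### The theorem of Łoś for the matrix ultraproduct -/

/-- The `n`-th entries of a tuple of bounded sequences. -/
noncomputable def entries (x : ℕ → boundedSeq.{u}) (n : ℕ+) : ℕ → matStr.{u} n := fun j => (x j).1 n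

/-- The tuple of classes of a tuple of bounded sequences. -/
noncomputable def classes (U : Ultrafilter ℕ+) (x : ℕ → boundedSeq.{u}) : ℕ → matUltraproduct.{u} U :=
  fun j => Ideal.Quotient.mk (nullIdeal U) (x j)

theorem entries_update (x : ℕ → boundedSeq.{u}) (i : ℕ) (a : boundedSeq.{u}) (n : ℕ+) :
    entries (Function.update x i a) n = Function.update (entries x n) i (a.1 n) := by
  funext j
  rcases eq_or_ne j i with rfl | h
  · simp [entries]
  · simp [entries, h]

theorem classes_update (U : Ultrafilter ℕ+) (x : ℕ → boundedSeq.{u}) (i : ℕ) (a : boundedSeq.{u}) :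
    classes U (Function.update x i a) =
      Function.update (classes U x) i (Ideal.Quotient.mk (nullIdeal U) a) := by
  funext j
  rcases eq_or_ne j i with rfl | h
  · simp [classes]
  · simp [classes, h]

theorem exists_entries_le (x : ℕ → boundedSeq.{u}) :
    ∃ r : ℕ → ℝ, (∀ j, 0 < r j) ∧ ∀ n j, ‖entries x n j‖ ≤ r j := by
  choose C hC using fun j => (x j).2
  exact ⟨fun j => |C j| + 1, fun j => by positivity, fun n j =>
    (hC j n).trans ((le_abs_self _).trans (by linarith))⟩

theorem exists_classes_eq (U : Ultrafilter ℕ+) (X : ℕ → matUltraproduct.{u} U) :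
    ∃ x, classes U x = X := by
  choose x hx using fun j => Ideal.Quotient.mk_surjective (X j)
  exact ⟨x, funext hx⟩

theorem Term.exists_eval_classes (U : Ultrafilter ℕ+) (x : ℕ → boundedSeq.{u}) (t : Term) :
    ∃ y : boundedSeq.{u}, (∀ n, y.1 n = t.eval (matStr n) (entries x n)) ∧
      t.eval (matUltraproduct U) (classes U x) = Ideal.Quotient.mk (nullIdeal U) y := by
  induction t with
  | var i => exact ⟨x i, fun n => rfl, rfl⟩
  | zero => exact ⟨0, fun n => rfl, rfl⟩
  | one => exact ⟨1, fun n => rfl, rfl⟩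
  | add s t hs ht =>
    obtain ⟨y, hy, h⟩ := hs
    obtain ⟨z, hz, h'⟩ := ht
    exact ⟨y + z, fun n => congrArg₂ (· + ·) (hy n) (hz n), congrArg₂ (· + ·) h h'⟩
  | mul s t hs ht =>
    obtain ⟨y, hy, h⟩ := hs
    obtain ⟨z, hz, h'⟩ := ht
    exact ⟨y * z, fun n => congrArg₂ (· * ·) (hy n) (hz n), congrArg₂ (· * ·) h h'⟩
  | star t ht =>
    obtain ⟨y, hy, h⟩ := ht
    exact ⟨Star.star y, fun n => congrArg Star.star (hy n), congrArg Star.star h⟩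
  | smul c t ht =>
    obtain ⟨y, hy, h⟩ := ht
    exact ⟨c • y, fun n => congrArg (c • ·) (hy n), congrArg (c • ·) h⟩

theorem exists_mem_D_of_eventually {U : Ultrafilter ℕ+} {r : ℝ} (hr : 0 < r)
    {p : ∀ n : ℕ+, Mat.{u} n → Prop} (h : ∀ᶠ n in U, ∃ a, ‖a‖ ≤ r ∧ p n a) :
    ∃ a : boundedSeq.{u}, (∀ n, ‖a.1 n‖ ≤ r) ∧ ∀ᶠ n in U, p n (a.1 n) := by
  classical
  have h1 : ∀ n, ∃ a : Mat.{u} n, ‖a‖ ≤ r ∧ ((∃ a, ‖a‖ ≤ r ∧ p n a) → p n a) := fun n => by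
    by_cases hn : ∃ a, ‖a‖ ≤ r ∧ p n a
    · obtain ⟨a, ha, ha'⟩ := hn
      exact ⟨a, ha, fun _ => ha'⟩
    · exact ⟨0, norm_zero.trans_le hr.le, fun h => absurd h hn⟩
  choose a ha ha' using h1
  exact ⟨⟨a, r, ha⟩, ha, h.mono fun n hn => ha' n hn⟩

/-- The theorem of Łoś. -/
theorem Formula.tendsto_eval (U : Ultrafilter ℕ+) (φ : Formula) : ∀ x : ℕ → boundedSeq.{u},
    Tendsto (fun n => φ.eval (matStr n) (entries x n)) U
      (𝓝 (φ.eval (matUltraproduct U) (classes U x))) := by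
  induction φ using Formula.induction_eval.{u} with
  | reTr t =>
    intro x
    obtain ⟨y, hy, h⟩ := t.exists_eval_classes U x
    simp only [Formula.eval, h, ← hy]
    exact (Complex.continuous_re.tendsto _).comp (tendsto_ntr U y)
  | conn F φ ih =>
    intro x
    exact (F.continuous.tendsto _).comp (tendsto_pi_nhds.2 fun l => ih l x)
  | sup i s φ ih =>
    intro x
    obtain ⟨r, hr, hx⟩ := exists_entries_le x
    obtain ⟨C, hC⟩ := φ.exists_abs_eval_le.{u} (Function.update r i s)
    have hb : ∀ n, BddAbove (Set.range fun a : (matStr.{u} n).D s =>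
        φ.eval (matStr n) (Function.update (entries x n) i a)) := fun n => by
      refine ⟨C, ?_⟩
      rintro _ ⟨a, rfl⟩
      exact (abs_le.1 (hC (matAlg n) _ (norm_update_le (hx n) a.2))).2
    have hlim : ∀ a : boundedSeq.{u}, Tendsto (fun n => φ.eval (matStr n)
        (Function.update (entries x n) i (a.1 n))) U (𝓝 (φ.eval (matUltraproduct U)
          (Function.update (classes U x) i (Ideal.Quotient.mk (nullIdeal U) a)))) := fun a => by
      have h := ih (Function.update x i a)
      simp only [entries_update, classes_update] at h
      exact h
    -- The ultraproduct enters only as a `TracialStructure`; its bound is inherited in the limit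
    -- from the bound `C`, which is the same for all `n`.
    have hbQ : BddAbove (Set.range fun a : (matUltraproduct.{u} U).D s =>
        φ.eval (matUltraproduct U) (Function.update (classes U x) i a)) := by
      refine ⟨C, ?_⟩
      rintro _ ⟨⟨_, a, ha, rfl⟩, rfl⟩
      exact le_of_tendsto (hlim a) (Eventually.of_forall fun n =>
        (abs_le.1 (hC (matAlg n) _ (norm_update_le (hx n) (ha n)))).2)
    have hne : ∀ n, Nonempty ((matStr.{u} n).D s) := fun n => ⟨0, norm_zero.trans_le s.2.le⟩
    have hneQ : Nonempty ((matUltraproduct.{u} U).D s) :=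
      ⟨_, 0, fun n => norm_zero.trans_le s.2.le, rfl⟩
    refine tendsto_order.2 ⟨fun b hb' => ?_, fun b hb' => ?_⟩
    · obtain ⟨⟨_, a, ha, rfl⟩, hlt⟩ := exists_lt_of_lt_ciSup hb'
      filter_upwards [(tendsto_order.1 (hlim a)).1 b hlt] with n hn
      exact hn.trans_le (le_ciSup (hb n) ⟨a.1 n, ha n⟩)
    -- Otherwise, for `U`-almost all `n`, some matrix in `D_s` gives a value above `b'`; the class
    -- of such a sequence gives a value at least `b'` in the ultraproduct, above its supremum.
    · obtain ⟨b', hb1, hb2⟩ := exists_between hb'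
      by_contra hcon
      have hcon := Ultrafilter.eventually_not.2 hcon
      have h1 : ∀ᶠ n in U, ∃ a : Mat.{u} n, ‖a‖ ≤ s ∧
          b' < φ.eval (matStr n) (Function.update (entries x n) i a) := by
        filter_upwards [hcon] with n hn
        obtain ⟨a, ha⟩ := exists_lt_of_lt_ciSup (hb2.trans_le (not_lt.1 hn))
        exact ⟨a, a.2, ha⟩
      obtain ⟨a, ha, ha'⟩ := exists_mem_D_of_eventually s.2 h1
      have h2 := ge_of_tendsto (hlim a) (ha'.mono fun n hn => hn.le)
      exact absurd (h2.trans (le_ciSup hbQ ⟨_, a, ha, rfl⟩)) (not_le.2 hb1)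
  | congr φ ψ h ih =>
    intro x
    simp only [← h]
    exact ih x

theorem matUltraproduct_models (U : Ultrafilter ℕ+) :
    (matUltraproduct.{u} U).Models tracialTheory.{u} := by
  intro σ hσ X
  obtain ⟨x, rfl⟩ := exists_classes_eq U X
  refine tendsto_nhds_unique (σ.tendsto_eval U x) ?_
  rw [funext fun n => hσ.2 (matAlg n) (entries x n)]
  exact tendsto_const_nhds

/-! ### Saturation of the matrix ultraproduct -/

theorem eventually_ge_of_nonprincipal {U : Ultrafilter ℕ+} (hU : ∀ n : ℕ+, U ≠ pure n) (k : ℕ) :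
    ∀ᶠ n : ℕ+ in U, k ≤ n := by
  have h : (U : Filter ℕ+) ≤ cofinite := U.le_cofinite_or_eq_pure.resolve_right fun ⟨n, hn⟩ =>
    hU n hn
  refine h ((Set.finite_Iio (k.succPNat)).subset fun n hn => ?_)
  rw [Set.mem_compl_iff, Set.mem_ofPred_eq, not_le] at hn
  exact PNat.coe_lt_coe _ _ |>.1 (hn.trans (Nat.lt_succ_self k))

/-- At stage `n`, meet as many of the first conditions as possible, with tolerance shrinking as
their number grows. Along `U` this number exceeds every `k`. -/
theorem exists_diagonal {U : Ultrafilter ℕ+} (hU : ∀ n : ℕ+, U ≠ pure n) {α : ℕ+ → Type*}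
    (P : ∀ n, α n → Prop) (f : ∀ n, ℕ → α n → ℝ) (v : ℕ → ℝ) (hP : ∀ n, ∃ X, P n X)
    (h : ∀ k : ℕ, ∀ ε : ℝ, 0 < ε → ∀ᶠ n in U, ∃ X, P n X ∧ ∀ l < k, |f n l X - v l| < ε) :
    ∃ X : ∀ n, α n, (∀ n, P n (X n)) ∧ ∀ l, Tendsto (fun n => f n l (X n)) U (𝓝 (v l)) := by
  classical
  let Q : ∀ n : ℕ+, ℕ → Prop := fun n k => ∃ X, P n X ∧ ∀ l < k, |f n l X - v l| < 1 / (k + 1)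
  -- The cap `n` makes the maximum exist even if `Q n k` holds for every `k`; it is harmless since
  -- `k ≤ n` eventually along a non-principal `U`.
  let K : ℕ+ → ℕ := fun n => Nat.findGreatest (Q n) n
  have hQ : ∀ n, Q n (K n) := fun n => by
    have h0 : Q n 0 := (hP n).imp fun X hX => ⟨hX, fun l hl => absurd hl (Nat.not_lt_zero l)⟩
    exact Nat.findGreatest_spec (Nat.zero_le _) h0
  choose X hX hX' using hQ
  refine ⟨X, hX, fun l => ?_⟩
  rw [Metric.tendsto_nhds]
  intro ε hε
  obtain ⟨m, hm⟩ := exists_nat_one_div_lt hε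
  let k := max m (l + 1)
  filter_upwards [h k (1 / ((k : ℝ) + 1)) (by positivity), eventually_ge_of_nonprincipal hU k]
    with n hn hkn
  have hk : k ≤ K n := Nat.le_findGreatest hkn hn
  have h1 := hX' n l ((Nat.lt_succ_self l).trans_le ((le_max_right m (l + 1)).trans hk))
  have h2 : (1 : ℝ) / (K n + 1) ≤ 1 / (m + 1) := by
    have : (m : ℝ) ≤ K n := by exact_mod_cast (le_max_left m (l + 1)).trans hk
    gcongr
  rw [Real.dist_eq]
  exact h1.trans_le (h2.trans hm.le)

/-- Countable saturation of the matrix ultraproduct: the type `tp X` over the parameters `y_j`,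
`j ∈ E`, is realized if it is finitely approximately satisfied along the ultrafilter. -/
theorem exists_tp_classes_eq {U : Ultrafilter ℕ+} (hU : ∀ n : ℕ+, U ≠ pure n)
    (M : TracialWStarAlgebra.{u}) (X : ℕ → M) (E : Set ℕ) (y : ℕ → boundedSeq.{u}) (r : ℕ → ℝ)
    (hr : ∀ j, 0 < r j)
    (h : ∀ (k : ℕ) (φ : Fin k → Formula) (ε : ℝ), 0 < ε → ∀ᶠ n in U, ∃ Y : ℕ → Mat.{u} n,
      (∀ j, (j ∈ E → Y j = (y j).1 n) ∧ (j ∉ E → ‖Y j‖ ≤ r j)) ∧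
        ∀ l, |(φ l).eval (matStr n) Y - (φ l).eval M.str X| < ε) :
    ∃ z : ℕ → boundedSeq.{u}, (∀ j ∈ E, z j = y j) ∧ (∀ j ∉ E, ∀ n, ‖(z j).1 n‖ ≤ r j) ∧
      tp (matUltraproduct U) (classes U z) = tp M.str X := by
  classical
  obtain ⟨S, hS, hS'⟩ := exists_countable_formulas_approx.{u}
  have hne : S.Nonempty := by
    obtain ⟨ψ, hψ, -⟩ := hS' (.reTr .zero) 0 0 1 one_pos
    exact ⟨ψ, hψ⟩
  obtain ⟨φ, rfl⟩ := hS.exists_eq_range hne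
  obtain ⟨Z, hZ, hlim⟩ := exists_diagonal hU (α := fun n => ℕ → Mat.{u} n)
    (fun n Y => ∀ j, (j ∈ E → Y j = (y j).1 n) ∧ (j ∉ E → ‖Y j‖ ≤ r j))
    (fun n l Y => (φ l).eval (matStr n) Y) (fun l => (φ l).eval M.str X)
    (fun n => ⟨fun j => if j ∈ E then (y j).1 n else 0, fun j =>
      ⟨fun hj => if_pos hj, fun hj => by simpa [hj] using (hr j).le⟩⟩)
    (fun k ε hε => (h k (fun l => φ l) ε hε).mono fun n ⟨Y, hY, hY'⟩ =>
      ⟨Y, hY, fun l hl => hY' ⟨l, hl⟩⟩)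
  have hbd : ∀ j, ∃ C, ∀ n, ‖Z n j‖ ≤ C := fun j => by
    by_cases hj : j ∈ E
    · obtain ⟨C, hC⟩ := (y j).2
      exact ⟨C, fun n => ((hZ n j).1 hj) ▸ hC n⟩
    · exact ⟨r j, fun n => (hZ n j).2 hj⟩
  let z : ℕ → boundedSeq.{u} := fun j => ⟨fun n => Z n j, hbd j⟩
  refine ⟨z, fun j hj => Subtype.ext (funext fun n => (hZ n j).1 hj),
    fun j hj n => (hZ n j).2 hj, funext fun χ => ?_⟩
  refine tendsto_nhds_unique (χ.tendsto_eval U z) ?_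
  rw [Metric.tendsto_nhds]
  intro ε hε
  obtain ⟨R, -, hR⟩ := exists_entries_le z
  -- One approximant `φ l` serves `M` and all matrix algebras at once, which leaves only the
  -- convergence of `φ l` to check.
  obtain ⟨_, ⟨l, rfl⟩, hl⟩ := hS' χ 1 (fun j => max (R j) ‖X j‖) (ε / 3) (by positivity)
  simp only [Pi.one_apply, one_smul] at hl
  filter_upwards [Metric.tendsto_nhds.1 (hlim l) (ε / 3) (by positivity)] with n hn
  have h1 := hl (matAlg n) (entries z n) fun j => (hR n j).trans (le_max_left _ _)
  have h2 := hl M X fun j => le_max_right _ _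
  rw [Real.dist_eq] at hn ⊢
  have hn' : |(φ l).eval (matStr n) (entries z n) - (φ l).eval M.str X| < ε / 3 := hn
  rw [abs_lt] at hn' ⊢
  rw [abs_le] at h1 h2
  constructor <;> simp only [tp] <;> linarith [h1.1, h1.2, h2.1, h2.2, hn'.1, hn'.2]

/-- A tuple of `M` that is matched on the variables in `E` by a tuple of the matrix ultraproduct
is matched entirely by a tuple with the same entries in `E`. -/
theorem exists_tp_eq_of_agree {U : Ultrafilter ℕ+} (hU : ∀ n : ℕ+, U ≠ pure n)
    (M : TracialWStarAlgebra.{u}) (X : ℕ → M) (E : Set ℕ) (Y : ℕ → matUltraproduct.{u} U)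
    (h : ∀ φ : Formula, φ.freeVars ⊆ E →
      φ.eval (matUltraproduct U) Y = φ.eval M.str X)
    (r : ℕ → ℝ) (hr : ∀ j, 0 < r j) (hX : ∀ j ∉ E, X j ∈ M.str.D (r j)) :
    ∃ Z : ℕ → matUltraproduct.{u} U, (∀ j ∈ E, Z j = Y j) ∧
      (∀ j ∉ E, Z j ∈ (matUltraproduct.{u} U).D (r j)) ∧
      tp (matUltraproduct U) Z = tp M.str X := by
  classical
  obtain ⟨y, rfl⟩ := exists_classes_eq U Y
  obtain ⟨z, hz, hz', hz''⟩ := exists_tp_classes_eq hU M X E y r hr fun k φ ε hε => by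
    let v : Fin k → ℝ := fun l => (φ l).eval M.str X
    let ψ := Formula.sumDist φ v
    let L : List ℕ := (ψ.finite_freeVars.toFinset.filter (· ∉ E)).toList
    let ρ : ℕ → Set.Ioi (0 : ℝ) := fun j => ⟨r j, hr j⟩
    have hL : ∀ j, j ∈ L ↔ j ∈ ψ.freeVars ∧ j ∉ E := fun j => by simp [L]
    -- With the variables outside `E` quantified out, `h` applies. The infimum vanishes in `M`
    -- because `X` itself is a witness, hence it vanishes in the ultraproduct and is small in the
    -- matrices.
    have hfree : (ψ.infList ρ L).freeVars ⊆ E := by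
      rw [Formula.freeVars_infList]
      rintro j ⟨hj, hj'⟩
      by_contra hjE
      exact hj' ((hL j).2 ⟨hj, hjE⟩)
    have hψ : ∀ X : ℕ → M.str, 0 ≤ ψ.eval M.str X := Formula.sumDist_nonneg M.str φ v
    have h0 : (ψ.infList ρ L).eval M.str X = 0 := by
      refine le_antisymm ?_ (Formula.infList_nonneg hψ L X)
      refine (Formula.infList_le hψ L X fun j hj => hX j ((hL j).1 hj).2).trans_eq ?_
      simp [ψ, v, Formula.eval_sumDist]
    have hlim := (ψ.infList ρ L).tendsto_eval U y
    rw [h _ hfree, h0] at hlim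
    filter_upwards [(tendsto_order.1 hlim).2 ε hε] with n hn
    obtain ⟨W, hW, hW', hlt⟩ := Formula.exists_lt_of_infList_lt
      (fun j => ⟨0, norm_zero.trans_le (hr j).le⟩) L _ hn
    -- Off `E` and `L` the tuple `W` keeps the entries of `y`, which may violate the bounds `r`;
    -- these variables are not free in any `φ l`, so 0 can replace them.
    refine ⟨fun j => if j ∈ E ∨ j ∈ L then W j else 0, fun j => ⟨fun hj => ?_, fun hj => ?_⟩,
      fun l => ?_⟩
    · refine (if_pos (Or.inl hj)).trans ?_
      exact hW j fun hj' => ((hL j).1 hj').2 hj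
    · by_cases hjL : j ∈ L
      · exact (congrArg norm (if_pos (Or.inr hjL))).trans_le (hW' j hjL)
      · exact (congrArg norm (if_neg (not_or.2 ⟨hj, hjL⟩))).trans_le
          (norm_zero.trans_le (hr j).le)
    · have e : (φ l).eval (matStr n) (fun j => if j ∈ E ∨ j ∈ L then W j else 0) =
          (φ l).eval (matStr n) W := Formula.eval_congr _ _ fun j hj => by
        refine if_pos ?_
        by_cases hjE : j ∈ E
        · exact Or.inl hjE
        · exact Or.inr ((hL j).2 ⟨Set.mem_iUnion.2 ⟨l, hj⟩, hjE⟩)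
      rw [e]
      refine lt_of_le_of_lt ?_ hlt
      exact Finset.single_le_sum (f := fun l => |(φ l).eval (matStr n) W - v l|)
        (fun l _ => abs_nonneg _) (Finset.mem_univ l)
  exact ⟨classes U z, fun j hj => congrArg _ (hz j hj), fun j hj => ⟨z j, hz' j hj, rfl⟩, hz''⟩

/-! ### Operator norm bounds are expressed by formulas -/

/-- Test the hypothesis on `z = a⁻`, the negative part of `a = r² - x*x`. It gives `τ(a⁻ a a⁻) ≥ 0`,
while `a⁻ a a⁻ = -(a⁻)³`. Faithfulness then forces `a⁻ = 0`, that is, `x*x ≤ r²`. -/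
theorem TracialWStarAlgebra.norm_le_of_forall_re_τ_le (M : TracialWStarAlgebra.{u}) {x : M} {r : ℝ}
    (hr : 0 ≤ r)
    (h : ∀ z : M, (M.τ (star (x * z) * (x * z))).re ≤ r ^ 2 * (M.τ (star z * z)).re) :
    ‖x‖ ≤ r := by
  let _ : PartialOrder M := CStarAlgebra.spectralOrder M
  have _ : StarOrderedRing M := CStarAlgebra.spectralOrderedRing M
  let a : M := algebraMap ℝ M (r ^ 2) - star x * x
  have ha : IsSelfAdjoint a :=
    (IsSelfAdjoint.algebraMap M (IsSelfAdjoint.all _)).sub (IsSelfAdjoint.star_mul_self x)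
  obtain ⟨b, hb⟩ := CStarAlgebra.nonneg_iff_eq_star_mul_self.1 (CFC.negPart_nonneg a)
  have hn : IsSelfAdjoint a⁻ := (CFC.negPart_nonneg a).isSelfAdjoint
  have e1 : star (b * a⁻) * (b * a⁻) = -(star a⁻ * a * a⁻) := by
    have h1 : a * a⁻ = -(a⁻ * a⁻) := by
      nth_rewrite 1 [← CFC.posPart_sub_negPart a ha]
      rw [sub_mul, CFC.posPart_mul_negPart, zero_sub]
    rw [star_mul, hn.star_eq, mul_assoc, ← mul_assoc (star b), ← hb, mul_assoc, h1, mul_neg, neg_neg]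
  have e2 : star a⁻ * a * a⁻ = ((r ^ 2 : ℝ) : ℂ) • (star a⁻ * a⁻) - star (x * a⁻) * (x * a⁻) := by
    have h2 : a = ((r ^ 2 : ℝ) : ℂ) • 1 - star x * x := by
      rw [Complex.coe_smul, ← Algebra.algebraMap_eq_smul_one]
    rw [h2, mul_sub, sub_mul, mul_smul_comm, mul_one, smul_mul_assoc, star_mul]
    simp only [mul_assoc]
  have h3 := M.nonneg (b * a⁻)
  have h4 : M.τ (star (b * a⁻) * (b * a⁻)) = 0 := by
    refine le_antisymm (Complex.le_def.2 ⟨?_, (Complex.le_def.1 h3).2.symm⟩) h3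
    rw [e1, e2, map_neg, map_sub, map_smul, smul_eq_mul, Complex.neg_re, Complex.sub_re,
      Complex.re_ofReal_mul, Complex.zero_re]
    linarith [h a⁻]
  have h5 : b * a⁻ = 0 := M.faithful _ h4
  have h6 : a⁻ = 0 := by
    rw [← CStarRing.star_mul_self_eq_zero_iff, hn.star_eq]
    nth_rewrite 1 [hb]
    rw [mul_assoc, h5, mul_zero]
  have h7 : 0 ≤ a := (CFC.negPart_eq_zero_iff a ha).1 h6
  have h8 : ‖star x * x‖ ≤ r ^ 2 :=
    (CStarAlgebra.norm_le_iff_le_algebraMap _ (by positivity) (star_mul_self_nonneg x)).2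
      (sub_nonneg.1 h7)
  rw [CStarRing.norm_star_mul_self] at h8
  exact le_of_sq_le_sq (by rw [sq]; exact h8) hr

/-- The integrand of `Formula.normExcess`. -/
def Formula.normExcessAux (j : ℕ) (r : ℝ) : Formula :=
  .conn (k := 2) ⟨fun v => max (v 0 - r ^ 2 * v 1) 0, by fun_prop⟩
    ![.reTr (.mul (.star (.mul (.var j) (.var (j + 1)))) (.mul (.var j) (.var (j + 1)))),
      .reTr (.mul (.star (.var (j + 1))) (.var (j + 1)))]

/-- The formula `sup_{z ∈ D_s} max (‖x_j z‖₂² - r² ‖z‖₂²) 0`. -/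
def Formula.normExcess (j : ℕ) (r : ℝ) (s : Set.Ioi (0 : ℝ)) : Formula :=
  .sup (j + 1) s (.normExcessAux j r)

theorem Formula.eval_normExcessAux (A : TracialStructure.{u}) (j : ℕ) (r : ℝ) (X : ℕ → A) (z : A) :
    (normExcessAux j r).eval A (Function.update X (j + 1) z) =
      max ((A.tr (star (X j * z) * (X j * z))).re - r ^ 2 * (A.tr (star z * z)).re) 0 := by
  simp [normExcessAux, Formula.eval, Term.eval]

theorem eval_normExcess_matStr (n : ℕ+) (j : ℕ) (r : ℝ) (s : Set.Ioi (0 : ℝ))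
    (X : ℕ → matStr.{u} n) (hX : ‖X j‖ ≤ r) : (Formula.normExcess j r s).eval (matStr n) X = 0 := by
  have h : ∀ z : Mat.{u} n, (Formula.normExcessAux j r).eval (matStr n)
      (Function.update X (j + 1) z) = 0 := fun z => by
    rw [Formula.eval_normExcessAux, max_eq_right]
    have h1 := (matAlg n).norm₂_sq (X j * z)
    have h2 := (matAlg n).norm₂_sq z
    have h3 : hsNorm n (X j * z) ≤ r * hsNorm n z := (hsNorm_mul_le n (X j) z).trans
      (mul_le_mul_of_nonneg_right hX (hsNorm_nonneg _ _))
    have h4 := pow_le_pow_left₀ (hsNorm_nonneg _ _) h3 2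
    rw [mul_pow] at h4
    rw [sub_nonpos]
    exact (h1.symm.trans_le h4).trans_eq (congrArg (r ^ 2 * ·) h2)
  simp only [Formula.normExcess, Formula.eval, h]
  exact Real.iSup_const_zero

theorem TracialWStarAlgebra.norm_le_of_normExcess_eq_zero (M : TracialWStarAlgebra.{u}) {X : ℕ → M}
    {j : ℕ} {r : ℝ} (hr : 0 ≤ r) (h : ∀ s, (Formula.normExcess j r s).eval M.str X = 0) :
    ‖X j‖ ≤ r := by
  refine M.norm_le_of_forall_re_τ_le hr fun z => ?_
  -- A positive radius whose ball contains `z`, also when `z = 0`.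
  let s : Set.Ioi (0 : ℝ) := ⟨‖z‖ + 1, Set.mem_Ioi.2 (by positivity)⟩
  obtain ⟨C, hC⟩ := (Formula.normExcessAux j r).exists_abs_eval_le.{u}
    (Function.update (fun j => ‖X j‖) (j + 1) s)
  have hb : BddAbove (Set.range fun a : M.str.D s =>
      (Formula.normExcessAux j r).eval M.str (Function.update X (j + 1) a)) := by
    refine ⟨C, ?_⟩
    rintro _ ⟨a, rfl⟩
    exact (abs_le.1 (hC M _ (norm_update_le (fun _ => le_rfl) a.2))).2
  have hz : z ∈ M.str.D s := by
    change ‖z‖ ≤ ‖z‖ + 1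
    linarith
  have h1 := (le_ciSup hb ⟨z, hz⟩).trans_eq (h s)
  rw [Formula.eval_normExcessAux] at h1
  exact sub_nonpos.1 ((le_max_left _ _).trans h1)

/-- `Formula.normExcess` vanishes on the matrix entries, hence at their classes by Łoś, hence at
every realization of `μ`. So a realization in a tracial `W*`-algebra obeys the same bounds as the
lifts. -/
theorem mem_bounded_of_tp_classes {U : Ultrafilter ℕ+} {μ : TypeSpace.{u}}
    {x : ℕ → boundedSeq.{u}} (hx : tp (matUltraproduct U) (classes U x) = μ.val) {r : ℕ → ℝ}
    (hr : ∀ j, 0 < r j) (hxr : ∀ n j, ‖entries x n j‖ ≤ r j) : μ ∈ TypeSpace.bounded r := by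
  obtain ⟨M, X, hX⟩ := μ.exists_realization
  refine ⟨M, X, fun j => M.norm_le_of_normExcess_eq_zero (hr j).le fun s => ?_, hX⟩
  have h1 := (Formula.normExcess j (r j) s).tendsto_eval U x
  rw [funext fun n => eval_normExcess_matStr n j (r j) s (entries x n) (hxr n j)] at h1
  have h2 := tendsto_nhds_unique h1 tendsto_const_nhds
  exact (congrFun (hX.trans hx.symm) _).trans h2

/-! ### Entropy and microstates -/

theorem tendsto_limUnder_eReal (U : Ultrafilter ℕ+) (f : ℕ+ → EReal) :
    Tendsto f U (𝓝 (limUnder (U : Filter ℕ+) f)) := by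
  obtain ⟨a, -, ha⟩ := isCompact_univ.ultrafilter_le_nhds (U.map f) (by simp)
  exact tendsto_nhds_limUnder ⟨a, ha⟩

theorem zero_le_entAux {U : Ultrafilter ℕ+} {r : ℕ → ℝ} {F : Finset ℕ} {ε : ℝ}
    {K : Set TypeSpace.{u}}
    (h : ∀ O, IsOpen O → K ⊆ O → ∀ᶠ n in U, (microstates r n O).Nonempty) :
    0 ≤ entAux U r F ε K := by
  refine le_iInf₂ fun O hO => ge_of_tendsto (tendsto_limUnder_eReal U _) ?_
  filter_upwards [h O hO.1 hO.2] with n hn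
  refine EReal.div_nonneg ?_ (EReal.coe_nonneg.2 (by positivity))
  have h1 : 1 ≤ orbCoveringNumber F ε (microstates r n O) := le_iInf₂ fun Ω' hΩ' => by
    obtain ⟨X, hX⟩ := hn
    obtain ⟨V, -, Y, hY, -⟩ := hΩ' hX
    exact Set.one_le_encard_iff_nonempty.2 ⟨Y, hY⟩
  rw [← ENNReal.log_one]
  exact ENNReal.log_monotone (by exact_mod_cast h1)

/-- If the microstates were empty for `U`-almost all `n`, the empty set would cover them, and the
limit for this `O` would be `⊥`. -/
theorem eventually_nonempty_of_entAux_ne_bot {U : Ultrafilter ℕ+} {r : ℕ → ℝ} {F : Finset ℕ}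
    {ε : ℝ} {K : Set TypeSpace.{u}} (h : entAux U r F ε K ≠ ⊥) {O : Set TypeSpace.{u}}
    (hO : IsOpen O) (hK : K ⊆ O) : ∀ᶠ n in U, (microstates r n O).Nonempty := by
  by_contra hcon
  have hcon := Ultrafilter.eventually_not.2 hcon
  refine h (eq_bot_iff.2 ((iInf₂_le O ⟨hO, hK⟩).trans ?_))
  refine (Tendsto.limUnder_eq (tendsto_const_nhds.congr' ?_)).le
  filter_upwards [hcon] with n hn
  have h0 : orbCoveringNumber F ε (microstates r n O) = 0 := by
    refine le_antisymm ((iInf₂_le ∅ ?_).trans_eq Set.encard_empty) zero_le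
    rw [Set.not_nonempty_iff_eq_empty.1 hn]
    exact Set.empty_subset _
  have hpos : (0 : ℝ) < ((n : ℕ) : ℝ) ^ 2 := by
    have : (0 : ℝ) < ((n : ℕ) : ℝ) := by exact_mod_cast n.pos
    positivity
  rw [h0]
  simp only [ENat.toENNReal_zero, ENNReal.log_zero]
  exact (EReal.bot_div_of_pos_ne_top (EReal.coe_pos.2 hpos) (EReal.coe_ne_top _)).symm

theorem isOpen_typeSpace_iff {O : Set TypeSpace.{u}} : IsOpen O ↔ ∀ r : ℕ → ℝ, (∀ j, 0 < r j) →
    ∃ t : Set (Formula → ℝ), IsOpen t ∧ ∀ μ ∈ TypeSpace.bounded.{u} r, μ.val ∈ t ↔ μ ∈ O := by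
  refine isOpen_iSup_iff.trans (Subtype.forall.trans
    (forall_congr' fun r => forall_congr' fun hr => ?_))
  rw [isOpen_coinduced, isOpen_induced_iff]
  refine exists_congr fun t => and_congr_right fun _ => ⟨fun h μ hμ => ?_, fun h => ?_⟩
  · exact Set.ext_iff.1 h ⟨μ, hμ⟩
  · exact Set.ext fun μ => h μ.1 μ.2

theorem isOpen_basic (μ : TypeSpace.{u}) {k : ℕ} (φ : Fin k → Formula) (ε : ℝ) :
    IsOpen {ν : TypeSpace.{u} | ∀ l, |ν.val (φ l) - μ.val (φ l)| < ε} := by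
  refine isOpen_typeSpace_iff.2 fun r _ =>
    ⟨⋂ l, {w | |w (φ l) - μ.val (φ l)| < ε}, isOpen_iInter_of_finite fun l => ?_, fun ν _ => ?_⟩
  · exact isOpen_lt (by fun_prop) continuous_const
  · simp

theorem exists_tp_eq_of_ent_ne_bot {U : Ultrafilter ℕ+} (hU : ∀ n : ℕ+, U ≠ pure n)
    {μ : TypeSpace.{u}} (h : ent U μ ≠ ⊥) :
    ∃ X : ℕ → matUltraproduct.{u} U, tp (matUltraproduct U) X = μ.val := by
  simp only [ent, entSet, entRadius, ne_eq, iSup_eq_bot, not_forall] at h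
  obtain ⟨r, hr, F, ε, -, h⟩ := h
  obtain ⟨M, X, hX⟩ := μ.exists_realization
  obtain ⟨z, -, -, hz⟩ := exists_tp_classes_eq hU M X ∅ 0 r hr fun k φ δ hδ => by
    filter_upwards [eventually_nonempty_of_entAux_ne_bot h (isOpen_basic μ φ δ)
      (Set.singleton_subset_iff.2 fun l => by simpa using hδ)] with n ⟨Y, hY, ν, hν, hνY⟩
    refine ⟨Y, fun j => ⟨fun hj => hj.elim, fun _ => hY j⟩, fun l => ?_⟩
    have h1 := hν l
    rw [hνY, ← hX] at h1
    exact h1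
  exact ⟨_, hz.trans hX⟩

theorem zero_le_ent_of_tp_eq {U : Ultrafilter ℕ+} {μ : TypeSpace.{u}}
    {X : ℕ → matUltraproduct.{u} U} (hX : tp (matUltraproduct U) X = μ.val) : 0 ≤ ent U μ := by
  obtain ⟨x, rfl⟩ := exists_classes_eq U X
  obtain ⟨r, hr, hxr⟩ := exists_entries_le x
  have hμ := mem_bounded_of_tp_classes hX hr hxr
  -- Any `F` and `ε` would do; only the radii `r` have to fit the lifts.
  refine le_trans (zero_le_entAux (F := ∅) (ε := 1) fun O hO hK => ?_)
    (le_iSup₂_of_le r hr (le_iSup_of_le ∅ (le_iSup₂_of_le 1 one_pos le_rfl)))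
  obtain ⟨t, ht, htO⟩ := isOpen_typeSpace_iff.1 hO r hr
  have hmem : μ.val ∈ t := (htO μ hμ).2 (hK rfl)
  rw [← hX] at hmem
  have hlim : Tendsto (fun n => tp (matStr n) (entries x n)) U
      (𝓝 (tp (matUltraproduct U) (classes U x))) :=
    tendsto_pi_nhds.2 fun φ => φ.tendsto_eval U x
  filter_upwards [hlim (ht.mem_nhds hmem)] with n hn
  exact ⟨entries x n, hxr n, (matAlg n).tp (entries x n),
    (htO _ ⟨matAlg n, entries x n, hxr n, rfl⟩).1 hn, rfl⟩

/-! ### Elementary embeddings into the matrix ultraproduct -/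

/-- The tuple `a₀, b₀, a₁, b₁, …`. -/
def interleave {α : Type*} (a b : ℕ → α) (j : ℕ) : α := if Even j then a (j / 2) else b (j / 2)

theorem interleave_even {α : Type*} (a b : ℕ → α) (k : ℕ) : interleave a b (2 * k) = a k := by
  simp [interleave]

theorem interleave_odd {α : Type*} (a b : ℕ → α) (k : ℕ) : interleave a b (2 * k + 1) = b k := by
  have h : (2 * k + 1) / 2 = k := by omega
  simp [interleave, h]

theorem tendsto_hsNorm (U : Ultrafilter ℕ+) (x : boundedSeq.{u}) :
    Tendsto (fun n => hsNorm n (x.1 n)) U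
      (𝓝 ((matUltraproduct.{u} U).norm₂ (Ideal.Quotient.mk (nullIdeal U) x))) :=
  (Real.continuous_sqrt.tendsto _).comp
    ((Complex.continuous_re.tendsto _).comp (tendsto_ntr U (star x * x)))

/-- Null sequences are divided out, so `‖·‖₂` separates points. The intermediate point `c` allows
two elements to be compared through a dense sequence. -/
theorem matUltraproduct_eq_of_forall_lt {U : Ultrafilter ℕ+} {a b : matUltraproduct.{u} U}
    (h : ∀ ε : ℝ, 0 < ε → ∃ c, (matUltraproduct U).dist₂ c a < ε ∧
      (matUltraproduct U).dist₂ c b < ε) : a = b := by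
  obtain ⟨x, rfl⟩ := Ideal.Quotient.mk_surjective a
  obtain ⟨y, rfl⟩ := Ideal.Quotient.mk_surjective b
  refine Ideal.Quotient.eq.2 ?_
  change Tendsto (fun n => hsNorm n ((x - y).1 n)) U (𝓝 0)
  rw [Metric.tendsto_nhds]
  intro ε hε
  -- With `ε / 2`, the estimate `‖u + v‖₂² ≤ 2‖u‖₂² + 2‖v‖₂²` yields exactly `ε²`.
  obtain ⟨c, h1, h2⟩ := h (ε / 2) (by positivity)
  obtain ⟨z, rfl⟩ := Ideal.Quotient.mk_surjective c
  filter_upwards [(tendsto_order.1 (tendsto_hsNorm U (z - x))).2 _ h1,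
    (tendsto_order.1 (tendsto_hsNorm U (z - y))).2 _ h2] with n hn1 hn2
  have e : (x - y).1 n = -(z - x).1 n + (z - y).1 n := by
    change x.1 n - y.1 n = -(z.1 n - x.1 n) + (z.1 n - y.1 n)
    abel
  have h3 := hsNorm_add_sq_le n (-(z - x).1 n) ((z - y).1 n)
  have h4 : hsNorm n (-(z - x).1 n) = hsNorm n ((z - x).1 n) := by
    simp only [hsNorm, star_neg, neg_mul_neg]
  have h5 := hsNorm_nonneg n ((z - x).1 n)
  have h6 := hsNorm_nonneg n ((z - y).1 n)
  rw [← e, h4] at h3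
  rw [Real.dist_eq, sub_zero, abs_of_nonneg (hsNorm_nonneg _ _)]
  refine lt_of_pow_lt_pow_left₀ 2 hε.le ?_
  nlinarith [pow_lt_pow_left₀ hn1 h5 two_ne_zero, pow_lt_pow_left₀ hn2 h6 two_ne_zero]

theorem TracialWStarAlgebra.eq_of_dist₂_eq_zero (M : TracialWStarAlgebra.{u}) {x y : M}
    (h : M.str.dist₂ x y = 0) : x = y := by
  refine sub_eq_zero.1 (M.faithful _ ?_)
  rw [M.τ_star_mul_self]
  have h' : M.str.norm₂ (x - y) = 0 := h
  simp [h']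

theorem TracialStructure.dist₂_self (A : TracialStructure.{u}) (x : A) : A.dist₂ x x = 0 := by
  simp [TracialStructure.dist₂, TracialStructure.norm₂]

theorem TracialStructure.dist₂_comm (A : TracialStructure.{u}) (x y : A) :
    A.dist₂ x y = A.dist₂ y x := by
  simp only [TracialStructure.dist₂, TracialStructure.norm₂]
  rw [← neg_sub, star_neg, neg_mul_neg]

/-- A map that preserves the values of all formulas is an elementary embedding. -/
theorem exists_isElementaryEmbedding_of_eval_eq {U : Ultrafilter ℕ+} {M : TracialWStarAlgebra.{u}}
    (ι : M → matUltraproduct.{u} U)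
    (hι : ∀ X : ℕ → M, tp (matUltraproduct U) (fun j => ι (X j)) = tp M.str X)
    (hD : ∀ x r, 0 < r → ‖x‖ ≤ r → ι x ∈ (matUltraproduct.{u} U).D r) :
    ∃ ι : M.str →⋆ₐ[ℂ] matUltraproduct.{u} U, IsElementaryEmbedding ι := by
  -- An identity between terms is the vanishing of a distance formula, so it transfers; every
  -- algebraic law for `ι` is an instance.
  have hterm : ∀ (s t : Term) (X : ℕ → M), s.eval M.str X = t.eval M.str X →
      s.eval (matUltraproduct U) (fun j => ι (X j)) =
        t.eval (matUltraproduct U) (fun j => ι (X j)) := fun s t X h => by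
    have h1 : (matUltraproduct U).dist₂ (s.eval (matUltraproduct U) fun j => ι (X j))
        (t.eval (matUltraproduct U) fun j => ι (X j)) =
          M.str.dist₂ (s.eval M.str X) (t.eval M.str X) := congrFun (hι X) (.dist s t)
    rw [h, TracialStructure.dist₂_self] at h1
    exact matUltraproduct_eq_of_forall_lt fun ε hε =>
      ⟨_, (TracialStructure.dist₂_self _ _).trans_lt hε, h1.trans_lt hε⟩
  let tup : M → M → M → ℕ → M := fun x y z j => if j = 0 then x else if j = 1 then y else z
  have hone : ι 1 = 1 := hterm (.var 0) .one (fun _ => 1) rfl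
  have hzero : ι 0 = 0 := hterm (.var 0) .zero (fun _ => 0) rfl
  have hsmul : ∀ (c : ℂ) (x : M), ι (c • x) = c • ι x := fun c x =>
    hterm (.var 1) (.smul c (.var 0)) (tup x (c • x) 0) rfl
  let f : M.str →⋆ₐ[ℂ] matUltraproduct.{u} U :=
    { toFun := ι
      map_one' := hone
      map_zero' := hzero
      map_mul' := fun x y => hterm (.var 2) (.mul (.var 0) (.var 1)) (tup x y (x * y)) rfl
      map_add' := fun x y => hterm (.var 2) (.add (.var 0) (.var 1)) (tup x y (x + y)) rfl
      commutes' := fun c => by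
        rw [Algebra.algebraMap_eq_smul_one, Algebra.algebraMap_eq_smul_one]
        exact (hsmul c 1).trans (congrArg (c • ·) hone)
      map_star' := fun x => hterm (.var 1) (.star (.var 0)) (tup x (star x) 0) rfl }
  refine ⟨f, ⟨⟨fun x y hxy => ?_, fun x => ?_, fun r hr x hx => hD x r hr hx⟩, fun φ hφ X => ?_⟩⟩
  · have h1 : (matUltraproduct U).dist₂ (ι x) (ι y) = M.str.dist₂ x y :=
      congrFun (hι (tup x y 0)) (.dist (.var 0) (.var 1))
    have h2 : ι x = ι y := hxy
    rw [h2, TracialStructure.dist₂_self] at h1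
    exact M.eq_of_dist₂_eq_zero h1.symm
  · exact Complex.ext (congrFun (hι fun _ => x) (.reTr (.var 0)))
      (congrFun (hι fun _ => x) (.imTr (.var 0)))
  · refine eq_of_forall_dist_le fun ε hε => ?_
    obtain ⟨ψ, hψ⟩ := hφ (fun j => ‖X j‖ + 1) (fun j => by positivity) (ε / 2) (by positivity)
    have hX : ∀ j, ‖X j‖ ≤ ‖X j‖ + 1 := fun j => by linarith
    -- Both structures are models, so the same `ψ` approximates `φ` in both, and `ι` preserves `ψ`.
    have h1 := abs_lt.1 (hψ M.str (fun σ hσ Y => hσ.2 M Y) X hX)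
    have h2 := abs_lt.1 (hψ _ (matUltraproduct_models U) (fun j => f (X j))
      fun j => hD _ _ (by positivity) (hX j))
    have h3 : ψ.eval (matUltraproduct U) (fun j => f (X j)) = ψ.eval M.str X := congrFun (hι X) ψ
    rw [h3] at h2
    rw [Real.dist_eq, abs_le]
    constructor <;> linarith [h1.1, h1.2, h2.1, h2.2]

theorem exists_isElementaryEmbedding {U : Ultrafilter ℕ+} (hU : ∀ n : ℕ+, U ≠ pure n)
    {M : TracialWStarAlgebra.{u}} (hM : M.IsSeparable) {X₀ : ℕ → M}
    {Y₀ : ℕ → matUltraproduct.{u} U} (h₀ : tp (matUltraproduct U) Y₀ = tp M.str X₀) :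
    ∃ ι : M.str →⋆ₐ[ℂ] matUltraproduct.{u} U, IsElementaryEmbedding ι := by
  obtain ⟨S, hS, hdense⟩ := hM
  obtain ⟨Z, rfl⟩ := hS.exists_eq_range
    (let ⟨y, hy, _⟩ := hdense 0 1 one_pos; ⟨y, hy⟩)
  have hpos : ∀ X : ℕ → M, ∀ j, 0 < ‖X j‖ + 1 := fun X j => by positivity
  have hle : ∀ X : ℕ → M, ∀ j, ‖X j‖ ≤ ‖X j‖ + 1 := fun X j => by linarith
  -- With no parameters, only agreement on sentences is used. The odd places are left free for
  -- further elements.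
  obtain ⟨W, -, -, hW⟩ := exists_tp_eq_of_agree hU M (interleave Z 0) ∅ Y₀
    (fun φ hφ => by
      rw [φ.eval_congr M.str (Y := X₀) fun i hi => (hφ hi).elim]
      exact congrFun h₀ φ) _ (hpos _) fun j _ => hle _ j
  let w : ℕ → matUltraproduct.{u} U := fun k => W (2 * k)
  have hext : ∀ (X : ℕ → M) (r : ℕ → ℝ), (∀ j, 0 < r j) → (∀ j, ‖X j‖ ≤ r j) →
      ∃ Y : ℕ → matUltraproduct.{u} U, (∀ j, Y j ∈ (matUltraproduct.{u} U).D (r j)) ∧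
        tp (matUltraproduct U) (interleave w Y) = tp M.str (interleave Z X) := by
    intro X r hr hX
    obtain ⟨V, hV, hVD, htp⟩ := exists_tp_eq_of_agree hU M (interleave Z X) {j | Even j} W
      (fun φ hφ => by
        rw [φ.eval_congr M.str (Y := interleave Z 0) fun i hi => by
          simp [interleave, show Even i from hφ hi]]
        exact congrFun hW φ)
      (fun j => r (j / 2)) (fun j => hr _) (fun j hj => by
        have hj' : ¬ Even j := hj
        change ‖interleave Z X j‖ ≤ r (j / 2)
        simpa [interleave, hj'] using hX (j / 2))
    refine ⟨fun k => V (2 * k + 1), fun k => ?_, ?_⟩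
    · have h1 := hVD (2 * k + 1) (Nat.not_even_bit1 k)
      have h2 : (2 * k + 1) / 2 = k := by omega
      rwa [h2] at h1
    · rw [← htp]
      congr 1
      funext j
      rcases Nat.even_or_odd' j with ⟨k, rfl | rfl⟩
      · rw [interleave_even]
        exact (hV _ (even_two_mul k)).symm
      · rw [interleave_odd]
  -- Extensions over `w` have no freedom: the image of an element has prescribed distances to all `w
  -- k`, and some of these are arbitrarily small.
  have huniq : ∀ (X X' : ℕ → M) (Y Y' : ℕ → matUltraproduct.{u} U),
      tp (matUltraproduct U) (interleave w Y) = tp M.str (interleave Z X) →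
      tp (matUltraproduct U) (interleave w Y') = tp M.str (interleave Z X') →
      ∀ i j, X i = X' j → Y i = Y' j := by
    have hdist : ∀ (X : ℕ → M) (Y : ℕ → matUltraproduct.{u} U),
        tp (matUltraproduct U) (interleave w Y) = tp M.str (interleave Z X) →
        ∀ k i, (matUltraproduct U).dist₂ (w k) (Y i) = M.str.dist₂ (Z k) (X i) := by
      intro X Y h k i
      have h1 := congrFun h (.dist (.var (2 * k)) (.var (2 * i + 1)))
      simp only [tp, Formula.eval, Term.eval, interleave_even, interleave_odd] at h1
      exact h1
    intro X X' Y Y' h h' i j hij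
    refine matUltraproduct_eq_of_forall_lt fun ε hε => ?_
    obtain ⟨_, ⟨k, rfl⟩, hk⟩ := hdense (X i) ε hε
    rw [TracialStructure.dist₂_comm] at hk
    refine ⟨w k, ?_, ?_⟩
    · rwa [hdist X Y h]
    · rwa [hdist X' Y' h', ← hij]
  choose Y hY hYtp using fun x : M => hext (fun _ => x) (fun _ => ‖x‖ + 1) (fun _ => by positivity)
    fun _ => by linarith
  refine exists_isElementaryEmbedding_of_eval_eq (fun x => Y x 0) (fun X => ?_)
    fun x r hr hx => ?_
  · obtain ⟨V, -, hV⟩ := hext X _ (hpos X) (hle X)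
    -- The joint extension for the whole tuple agrees with the separate choices, so the type of the
    -- tuple is preserved.
    have hVY : V = fun j => Y (X j) 0 :=
      funext fun j => huniq _ _ _ _ hV (hYtp (X j)) j 0 rfl
    have hinj : Function.Injective fun j : ℕ => 2 * j + 1 := fun a b hab => by
      simpa using hab
    funext φ
    -- Moving `φ` to the odd variables makes it speak of the tuple alone; injectivity prevents
    -- capture, as bound variables are renamed too.
    have h1 := congrFun hV (φ.rename fun j => 2 * j + 1)
    simp only [tp, Formula.eval_rename _ hinj] at h1
    have h2 : ∀ {α : Type u} (a b : ℕ → α), interleave a b ∘ (fun j => 2 * j + 1) = b :=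
      fun a b => funext fun j => interleave_odd a b j
    rw [h2, h2, hVY] at h1
    exact h1
  -- `Y x` was chosen with radius `‖x‖ + 1`. A second extension with radius `r` has the same entry
  -- by uniqueness, so that entry lies in `D_r`.
  · obtain ⟨V, hVD, hV⟩ := hext (fun _ => x) (fun _ => r) (fun _ => hr) fun _ => hx
    have h1 := hVD 0
    rwa [huniq _ _ _ _ hV (hYtp x) 0 0 rfl] at h1

end TracialEntropy

theorem mainTheorem12 (U : Ultrafilter ℕ+) (hU : ∀ n : ℕ+, U ≠ pure n) :
    (∀ μ : TypeSpace.{u},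
      (0 ≤ ent U μ ∨ ent U μ = ⊥) ∧
      (0 ≤ ent U μ ↔
        ∃ X : ℕ → matUltraproduct.{u} U, tp (matUltraproduct U) X = μ.val)) ∧
    (∀ M : TracialWStarAlgebra.{u}, M.IsSeparable → ∀ N : WStarSubalgebra M,
      0 ≤ entSubalgebra U N →
        ∃ ι : M.str →⋆ₐ[ℂ] matUltraproduct.{u} U, IsElementaryEmbedding ι) := by
  have hbot : ∀ a : EReal, 0 ≤ a → a ≠ ⊥ := fun a ha => (EReal.bot_lt_zero.trans_le ha).ne'
  refine ⟨fun μ => ⟨?_, fun h => exists_tp_eq_of_ent_ne_bot hU (hbot _ h),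
    fun ⟨X, hX⟩ => zero_le_ent_of_tp_eq hX⟩, fun M hM N hN => ?_⟩
  · by_cases h : ent U μ = ⊥
    · exact Or.inr h
    · obtain ⟨X, hX⟩ := exists_tp_eq_of_ent_ne_bot hU h
      exact Or.inl (zero_le_ent_of_tp_eq hX)
  · have hN' := hbot _ hN
    simp only [entSubalgebra, ne_eq, iSup_eq_bot, not_forall] at hN'
    obtain ⟨X, hX⟩ := hN'
    obtain ⟨Y, hY⟩ := exists_tp_eq_of_ent_ne_bot hU hX
    exact exists_isElementaryEmbedding hU hM hY
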